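/- Let $n,m\ge 1$ be integers. Put $$W_n(x)=\det\Big[\frac{\sin(\pi(x_i-x_j))}{\pi(x_i-x_j)}\Big]_{i,j=1}^n\quad(x\in\mathbb R^n),\qquad H_{n-1}=\{x\in\mathbb R^{n-1}: |x_1|+\dots+|x_{n-1}|+|x_1+\dots+x_{n-1}|\le 1\}$$ (diagonal entries equal to $1$), write $d\nu_n(v)=W_n(v,0)\,dv$ on $\mathbb R^{n-1}$, and let $\mathrm{PW}(\frac1mH_{n-1})$ be the space of $g\in L^2(\mathbb R^{n-1})$ whose Fourier transform $\widehat g$ (normalized with $e^{-2\pi i\langle x,\xi\rangle}$) is supported in $\frac1mH_{n-1}$; such $g$ is identified with its entire extension $g(z)=\int\widehat g(\xi)e^{2\pi i\langle z,\xi\rangle}\,d\xi$ to $\mathbb C^{n-1}$. Call $f:\mathbb R^n\to\mathbb R$ admissible if it is $C^\infty$, symmetric, invariant under $x\mapsto x+t(1,\dots,1)$ for $t\in\mathbb R$, has distributional Fourier transform with closed support contained in $\{|\xi_1|+\dots+|\xi_n|<2/m\}$, and decays faster than every power of $|x|$ on the hyperplane $\sum_jx_j=0$. Let $$c_{n,m}=\inf_f\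 \frac1{f(1,\dots,1)}\int_{\mathbb R^n}f(x)W_n(x)\,\delta\Big(\frac{x_1+\dots+x_n}{n}\Big)dx ,$$ the infimum being over nonnegative admissible $f$ with $f(1,\dots,1)>0$ (it is over a nonempty set bounded below). Then there is $a>0$ with $a\|g\|_2^2\le\nu_n(|g|^2)\le\|g\|_2^2$ for all $g\in\mathrm{PW}(\frac1mH_{n-1})$, and there is a unique kernel $K:\mathbb C^{n-1}\times\mathbb C^{n-1}\to\mathbb C$ such that $K(w,\cdot)\in\mathrm{PW}(\frac1mH_{n-1})$ for every $w$ and $$g(w)=\int_{\mathbb R^{n-1}}g(v)\overline{K(w,v)}\,d\nu_n(v)\qquad\text{for all } g\in\mathrm{PW}(\tfrac1mH_{n-1}),\ w\in\mathbb C^{n-1}.$$ Moreover $K(0,0)$ is real and positive, and $$c_{n,m}\le\frac1{K(0,0)} .$$ Equality holds if every nonnegative $g\in L^1(\mathbb R^{n-1})$ with $\operatorname{supp}\widehat g\subseteq\frac2mH_{n-1}$ is a sum of squares in the following sense: there are $g_{j,N}\in\mathrm{PW}(\frac1mH_{n-1})$ with $\sup_N\sum_{j=1}^N\|g_{j,N}\|_2^2<\infty$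 and $$g(x)=\lim_{N\to\infty}\sum_{j=1}^N|g_{j,N}(x)|^2\quad\text{for almost every }x .$$ -/

import Mathlib

open MeasureTheory Filter Topology
open scoped FourierTransform SchwartzMap Pointwise ContDiff ComplexConjugate

noncomputable section

namespace PairKernel

/-- Euclidean space `ℝ^k`. -/
abbrev E (k : ℕ) : Type := EuclideanSpace ℝ (Fin k)

/-- Dyson's limiting `n`-level correlation density
`W_n(x) = det [sin(π(x_i - x_j)) / (π(x_i - x_j))]` (diagonal entries equal to `1`);
`Real.sinc t` is `sin t / t` for `t ≠ 0` and `1` for `t = 0`. -/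
def dysonW (n : ℕ) (x : E n) : ℝ :=
  (Matrix.of fun i j : Fin n => Real.sinc (Real.pi * (x i - x j))).det

/-- The weight `x ↦ W_n(x, 0)` on `ℝ^{n-1}`, where `n = d + 1`. -/
def weight (d : ℕ) (x : E d) : ℝ :=
  dysonW (d + 1) (WithLp.toLp 2 (Fin.snoc (α := fun _ => ℝ) x 0))

/-- The convex body
`H_d = {x ∈ ℝ^d : |x_1| + ... + |x_d| + |x_1 + ... + x_d| ≤ 1}`. -/
def bodyH (d : ℕ) : Set (E d) :=
  {x | ∑ i, |x i| + |∑ i, x i| ≤ 1}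

/-- The Paley-Wiener space of `Ω ⊆ ℝ^d`: the `L²` functions whose Fourier transform is supported
in `Ω`. -/
def PW {d : ℕ} (Ω : Set (E d)) : Set (Lp ℂ 2 (volume : Measure (E d))) :=
  {g | ∀ᵐ ξ : E d, ξ ∉ Ω → (𝓕 g : Lp ℂ 2 (volume : Measure (E d))) ξ = 0}

/-- The entire extension to `ℂ^d` of a Paley-Wiener function `g` (for compact `Ω`):
`g(z) = ∫ ĝ(ξ) e^{2πi ⟨z, ξ⟩} dξ`. -/
def ext {d : ℕ} (g : Lp ℂ 2 (volume : Measure (E d))) (z : Fin d → ℂ) : ℂ :=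
  ∫ ξ : E d, (𝓕 g : Lp ℂ 2 (volume : Measure (E d))) ξ *
    Complex.exp (2 * Real.pi * Complex.I * ∑ i, z i * (ξ i : ℂ))

/-- The inclusion `ℝ^d → ℂ^d`. -/
def toC {d : ℕ} (x : E d) : Fin d → ℂ := fun i => (x i : ℂ)

/-- `K : ℂ^d × ℂ^d → ℂ` is a reproducing kernel of `PW Ω` for the inner product
`∫ g(v) conj(h(v)) W_n(v, 0) dv`, `n = d + 1`: every `K(w, ·)` is (the entire extension of) an
element of `PW Ω`, and `g(w) = ∫ g(v) conj(K(w, v)) W_n(v, 0) dv` for all `g ∈ PW Ω`, `w ∈ ℂ^d`. -/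
def IsReproducingKernel {d : ℕ} (Ω : Set (E d)) (K : (Fin d → ℂ) → (Fin d → ℂ) → ℂ) : Prop :=
  (∀ w, ∃ k ∈ PW Ω, ∀ z, K w z = ext k z) ∧
  ∀ g ∈ PW Ω, ∀ w : Fin d → ℂ,
    ext g w = ∫ v : E d, g v * conj (K w (toC v)) * (weight d v : ℂ)

/-- The support of the Fourier transform of `f`, in the sense of tempered distributions:
`⟨f̂, φ⟩ = ∫ f(x) φ̂(x) dx` for Schwartz functions `φ`. -/
def fourierSupport {n : ℕ} (f : E n → ℝ) : Set (E n) :=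
  Distribution.dsupport (fun φ : 𝓢(E n, ℂ) => ∫ x : E n, (f x : ℂ) * (𝓕 φ : 𝓢(E n, ℂ)) x)

/-- Admissible (real-valued) test functions on `ℝ^n` for the parameter `m`. -/
structure Admissible (n m : ℕ) (f : E n → ℝ) : Prop where
  smooth : ContDiff ℝ ∞ f
  symmetric : ∀ (σ : Equiv.Perm (Fin n)) (x : E n), f (WithLp.toLp 2 fun i => x (σ i)) = f x
  translation : ∀ (t : ℝ) (x : E n), f (WithLp.toLp 2 fun i => x i + t) = f x
  support : fourierSupport f ⊆ {ξ | ∑ i, |ξ i| < 2 / (m : ℝ)}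
  decay : ∀ k : ℕ, ∃ C : ℝ, ∀ x : E n, ∑ i, x i = 0 → ‖x‖ ^ k * |f x| ≤ C

/-- The integral `∫_{ℝ^n} F(x) δ((x_1 + ... + x_n) / n) dx`, `n = d + 1`. Integrating out the last
variable, `δ((y_1 + ... + y_d + t) / n)` is `n` times the point mass at `t = -(y_1 + ... + y_d)`. -/
def deltaIntegral (d : ℕ) (F : E (d + 1) → ℝ) : ℝ :=
  ((d : ℝ) + 1) *
    ∫ y : E d, F (WithLp.toLp 2 (Fin.snoc (α := fun _ => ℝ) y (-∑ i, y i)))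

/-- The values over which the optimal constant is the infimum, `n = d + 1`:
`f(1,...,1)⁻¹ ∫ f(x) W_n(x) δ((x_1 + ... + x_n) / n) dx` for nonnegative admissible `f`
(with `f(1,...,1) ≠ 0`). -/
def optValues (d m : ℕ) : Set ℝ :=
  {r | ∃ f : E (d + 1) → ℝ, Admissible (d + 1) m f ∧ (∀ x, 0 ≤ f x) ∧
    0 < f (WithLp.toLp 2 fun _ => 1) ∧
    r = 1 / f (WithLp.toLp 2 fun _ => 1) *
      deltaIntegral d (fun x => f x * dysonW (d + 1) x)}

/-- The optimal constant `c_{n,m}`, `n = d + 1`. -/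
def optConst (d m : ℕ) : ℝ := sInf (optValues d m)

/-- `g` is an almost everywhere limit, as `N → ∞`, of sums of squares `∑_{j ≤ N} |g_{j,N}|²` of
elements of `PW Ω`, the `L¹` norms of these sums being bounded. -/
def IsSumOfSquares {d : ℕ} (Ω : Set (E d)) (g : E d → ℝ) : Prop :=
  ∃ G : ℕ → ℕ → Lp ℂ 2 (volume : Measure (E d)),
    (∀ N j, G N j ∈ PW Ω) ∧
    (∃ C : ℝ, ∀ N, ∑ j ∈ Finset.range N, ‖G N j‖ ^ 2 ≤ C) ∧
    ∀ᵐ x : E d, Tendsto (fun N => ∑ j ∈ Finset.range N, ‖G N j x‖ ^ 2) atTop (𝓝 (g x))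

end PairKernel

end

/-!
Write `n = d + 1`, `Ω = (1/m) H_d` and `w = weight d`, so that `dν_n(v) = w(v) dv`.

*Norm equivalence.* The matrix of `dysonW` is the Gram matrix of the exponentials
`t ↦ exp(2πi xⱼ t)` in `L²[-1/2, 1/2]`. Hence `0 ≤ dysonW ≤ 1`, and a Turán-type inequality
(`exists_integral_trigSum_le`) bounds `dysonW` below, uniformly in the configuration, as soon as the
points are `δ`-separated (`exists_le_dysonW`). The configurations that are not `δ`-separated form a
finite union of slabs of width `O(δ)`. A function of `PW Ω` is reproduced by convolution with a
fixed Schwartz function, so for small `δ` it has at most half of its mass in these slabs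
(`exists_setIntegral_iUnion_slab_le`). This gives the lower bound for the weighted norm.

*Kernel.* Evaluation at a complex point is a bounded functional on `PW Ω`, because Fourier
transforms of its elements live on a fixed compact set. By the norm equivalence, the compression to
`PW Ω` of the multiplication by `w` is coercive, hence invertible, and this represents the
evaluations by vectors `k_z` for the weighted inner product (`exists_kernelVec`). Moreover
`K(0,0) = ν_n(|k_0|²)`.

*Upper bound.* For a test function `φ` in the interior of `Ω` put `g = 𝓕⁻ φ`. Then
`f(x) = ∑_σ |g(x_{σ(1)} - x_{σ(n)}, …, x_{σ(d)} - x_{σ(n)})|²` is admissible: its Fourier pairing is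
a double integral over frequencies (`integral_norm_sq_comp_mul_fourier`), which shows the
support condition. The corresponding value is `ν_n(|g|²) / |g(0)|²` (`mem_optValues`). Such `g` are
dense in `PW Ω`, since the boundary of a convex body is a null set, so the inequality
`c |g(0)|² ≤ ν_n(|g|²)` extends to `g = k_0` and gives `c ≤ 1 / K(0,0)` (`optConst_le`).

*Equality.* For an admissible `f ≥ 0`, the function `g(v) = f(v, 0)` is integrable and its Fourier
transform is supported in `2 Ω` (`Admissible.tsupport_fourier_subset`). Let `s_N` be the square root
of `∑_j |g_{j,N}|²`. Applying the reproducing property to `∑_j conj(g_{j,N}(0)) g_{j,N}` yields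
`s_N(0) ≤ ∫ s_N |k_0| w` (`rootSum_zero_le`). The mass of `s_N²` may escape to infinity, but
`s_N` is bounded in `L²` and converges almost everywhere, so it converges weakly
(`le_integral_of_tendsto`); with the equicontinuity of `s_N` at `0` this gives
`√g(0) ≤ ∫ √g |k_0| w`, whence `g(0) ≤ K(0,0) ∫ g w` by Cauchy–Schwarz
(`IsSumOfSquares.apply_zero_le`).
-/

namespace PairKernel

/-! ### Exponential sums and the sine kernel -/

/-- The exponential sum `t ↦ ∑ⱼ cⱼ exp(2πi xⱼ t)`. -/
noncomputable def trigSum {n : ℕ} (x c : Fin n → ℝ) (t : ℝ) : ℂ :=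
  ∑ j, (c j : ℂ) * Complex.exp ((2 * Real.pi * x j * t : ℝ) * Complex.I)

lemma continuous_trigSum {n : ℕ} (x c : Fin n → ℝ) : Continuous (trigSum x c) := by
  unfold trigSum; fun_prop

lemma norm_trigSum_sq {n : ℕ} (x c : Fin n → ℝ) (t : ℝ) :
    ‖trigSum x c t‖ ^ 2 = ∑ i, ∑ j, c i * c j * Real.cos (2 * Real.pi * (x i - x j) * t) := by
  have h : ∀ j, (c j : ℂ) * Complex.exp ((2 * Real.pi * x j * t : ℝ) * Complex.I) =
      ⟨c j * Real.cos (2 * Real.pi * x j * t), c j * Real.sin (2 * Real.pi * x j * t)⟩ := by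
    intro j
    rw [Complex.exp_mul_I]
    apply Complex.ext <;>
      simp [← Complex.ofReal_cos, ← Complex.ofReal_sin, -Complex.ofReal_mul]
  rw [← Complex.normSq_eq_norm_sq, Complex.normSq_apply]
  simp only [trigSum, h, Complex.re_sum, Complex.im_sum, Finset.sum_mul_sum,
    ← Finset.sum_add_distrib]
  refine Finset.sum_congr rfl fun i _ => Finset.sum_congr rfl fun j _ => ?_
  rw [show 2 * Real.pi * (x i - x j) * t = 2 * Real.pi * x i * t - 2 * Real.pi * x j * t by ring,
    Real.cos_sub]
  ring

lemma integral_cos_mul (y a b : ℝ) (hy : y ≠ 0) :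
    ∫ t in a..b, Real.cos (2 * Real.pi * y * t) =
      (Real.sin (2 * Real.pi * y * b) - Real.sin (2 * Real.pi * y * a)) / (2 * Real.pi * y) := by
  have h : 2 * Real.pi * y ≠ 0 := by positivity
  rw [intervalIntegral.integral_comp_mul_left (fun u => Real.cos u) h, integral_cos,
    smul_eq_mul, div_eq_inv_mul]

lemma integral_cos_eq_sinc (y : ℝ) :
    ∫ t in (-(1 / 2 : ℝ))..(1 / 2), Real.cos (2 * Real.pi * y * t) = Real.sinc (Real.pi * y) := by
  by_cases hy : y = 0
  · subst hy; norm_num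
  · rw [integral_cos_mul y _ _ hy, Real.sinc_of_ne_zero (by positivity),
      show 2 * Real.pi * y * (1 / 2) = Real.pi * y by ring,
      show 2 * Real.pi * y * -(1 / 2) = -(Real.pi * y) by ring, Real.sin_neg]
    field_simp
    ring

lemma integral_norm_trigSum_sq {n : ℕ} (x c : Fin n → ℝ) (a b : ℝ) :
    ∫ t in a..b, ‖trigSum x c t‖ ^ 2 =
      ∑ i, ∑ j, c i * c j * ∫ t in a..b, Real.cos (2 * Real.pi * (x i - x j) * t) := by
  simp only [norm_trigSum_sq]
  rw [intervalIntegral.integral_finsetSum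
    (fun i _ => Continuous.intervalIntegrable (by fun_prop) _ _)]
  refine Finset.sum_congr rfl fun i _ => ?_
  rw [intervalIntegral.integral_finsetSum
    (fun i _ => Continuous.intervalIntegrable (by fun_prop) _ _)]
  refine Finset.sum_congr rfl fun j _ => ?_
  rw [intervalIntegral.integral_const_mul]

lemma intervalIntegrable_trigSum {n : ℕ} (x c : Fin n → ℝ) (a b : ℝ) :
    IntervalIntegrable (fun t => ‖trigSum x c t‖ ^ 2) volume a b :=
  (((continuous_trigSum x c).norm).pow 2).intervalIntegrable _ _

/-- Over an interval much longer than the reciprocal of the gaps, the exponentials are almost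
orthogonal. -/
lemma le_integral_norm_trigSum_sq {n : ℕ} (x c : Fin n → ℝ) {δ : ℝ} (hδ : 0 < δ)
    (hx : ∀ i j, i ≠ j → δ ≤ |x i - x j|) (a b : ℝ) :
    (b - a - n / δ) * ∑ i, c i ^ 2 ≤ ∫ t in a..b, ‖trigSum x c t‖ ^ 2 := by
  have hoff : ∀ i j, i ≠ j →
      |∫ t in a..b, Real.cos (2 * Real.pi * (x i - x j) * t)| ≤ 1 / δ := by
    intro i j hij
    have h1 := hx i j hij
    have h0 : 0 < |x i - x j| := hδ.trans_le h1
    rw [integral_cos_mul _ _ _ (abs_pos.mp h0), abs_div, abs_mul, abs_of_pos Real.two_pi_pos]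
    have h2 : |Real.sin (2 * Real.pi * (x i - x j) * b) -
        Real.sin (2 * Real.pi * (x i - x j) * a)| ≤ 2 := by
      refine (abs_sub _ _).trans ?_
      linarith [Real.abs_sin_le_one (2 * Real.pi * (x i - x j) * b),
        Real.abs_sin_le_one (2 * Real.pi * (x i - x j) * a)]
    rw [div_le_div_iff₀ (by positivity) hδ]
    have := Real.pi_gt_three
    nlinarith
  have hterm : ∀ i j, (if i = j then (b - a) * c i ^ 2 else 0) - |c i| * |c j| * (1 / δ) ≤
      c i * c j * ∫ t in a..b, Real.cos (2 * Real.pi * (x i - x j) * t) := by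
    intro i j
    by_cases hij : i = j
    · subst hij
      have : (0:ℝ) ≤ |c i| * |c i| * (1 / δ) := by positivity
      simp only [if_true, sub_self, mul_zero, zero_mul, Real.cos_zero,
        intervalIntegral.integral_const, smul_eq_mul, mul_one]
      nlinarith
    · rw [if_neg hij, zero_sub]
      refine neg_le_of_neg_le ?_
      refine (neg_le_abs _).trans ?_
      rw [abs_mul, abs_mul]
      gcongr
      exact hoff i j hij
  have hcs : (∑ i, |c i|) * (∑ i, |c i|) ≤ n * ∑ i, c i ^ 2 := by
    have := sq_sum_le_card_mul_sum_sq (s := (Finset.univ : Finset (Fin n))) (f := fun i => |c i|)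
    simpa [sq_abs, pow_two, Finset.card_univ] using this
  rw [integral_norm_trigSum_sq]
  refine le_trans ?_ (Finset.sum_le_sum fun i _ => Finset.sum_le_sum fun j _ => hterm i j)
  simp only [Finset.sum_sub_distrib, Finset.sum_ite_eq, Finset.mem_univ, if_true,
    ← Finset.sum_mul, ← Finset.mul_sum]
  have : (∑ i, |c i|) * (∑ i, |c i|) * (1 / δ) ≤ n * (∑ i, c i ^ 2) * (1 / δ) := by gcongr
  have e : (b - a - n / δ) * ∑ i, c i ^ 2 =
    (b - a) * (∑ i, c i ^ 2) - n * (∑ i, c i ^ 2) * (1 / δ) := by ring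
  rw [e]; linarith

/-- An exponential sum with `n` frequencies solves a linear recurrence of order `n` along every
arithmetic progression, with coefficients bounded in terms of `n` only. -/
lemma exists_recurrence_trigSum (n : ℕ) : ∃ A : ℝ, 0 ≤ A ∧ ∀ (x c : Fin n → ℝ) (h t : ℝ),
    ‖trigSum x c (t + n * h)‖ ^ 2 ≤ A * ∑ k ∈ Finset.range n, ‖trigSum x c (t + k * h)‖ ^ 2 := by
  refine ⟨n * (n.choose (n / 2)) ^ 2, by positivity, fun x c h t => ?_⟩
  set z : Fin n → ℂ := fun j => Complex.exp ((2 * Real.pi * x j * h : ℝ) * Complex.I) with hz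
  set p : Polynomial ℂ := ∏ j, (Polynomial.X - Polynomial.C (z j)) with hp
  have hmonic : p.Monic := Polynomial.monic_prod_X_sub_C _ _
  have hdeg : p.natDegree = n := by
    rw [hp, Polynomial.natDegree_prod_of_monic _ _ fun j _ => Polynomial.monic_X_sub_C _]
    simp
  have hcoeff : ∀ i, ‖p.coeff i‖ ≤ n.choose (n / 2) := by
    intro i
    have := Polynomial.coeff_bdd_of_roots_le (B := 1) (d := n) (RingHom.id ℂ) hmonic
      (IsAlgClosed.splits _) hdeg.le ?_ i
    · simpa using this
    · intro w hw
      have hw0 : p.eval w = 0 := by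
        rw [Polynomial.map_id] at hw
        exact (Polynomial.mem_roots'.mp hw).2
      rw [hp, Polynomial.eval_prod, Finset.prod_eq_zero_iff] at hw0
      obtain ⟨j, _, hj⟩ := hw0
      rw [Polynomial.eval_sub, Polynomial.eval_X, Polynomial.eval_C, sub_eq_zero] at hj
      rw [hj]
      exact (Complex.norm_exp_ofReal_mul_I _).le
  have hroot : ∀ j, ∑ k ∈ Finset.range (n + 1), p.coeff k * z j ^ k = 0 := by
    intro j
    have h1 : p.eval (z j) = 0 := by
      rw [hp, Polynomial.eval_prod]
      exact Finset.prod_eq_zero (Finset.mem_univ j) (by simp)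
    rw [Polynomial.eval_eq_sum_range, hdeg] at h1
    exact h1
  have hshift : ∀ k : ℕ, trigSum x c (t + k * h) =
      ∑ j, (c j : ℂ) * Complex.exp ((2 * Real.pi * x j * t : ℝ) * Complex.I) * z j ^ k := by
    intro k
    refine Finset.sum_congr rfl fun j _ => ?_
    rw [hz, ← Complex.exp_nat_mul, mul_assoc (c j : ℂ), ← Complex.exp_add]
    congr 2
    push_cast
    ring
  have hrec : ∑ k ∈ Finset.range (n + 1), p.coeff k * trigSum x c (t + k * h) = 0 := by
    simp only [hshift, Finset.mul_sum]
    rw [Finset.sum_comm]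
    refine Finset.sum_eq_zero fun j _ => ?_
    have := hroot j
    calc _ = (c j : ℂ) * Complex.exp ((2 * Real.pi * x j * t : ℝ) * Complex.I) *
          ∑ k ∈ Finset.range (n + 1), p.coeff k * z j ^ k := by
          rw [Finset.mul_sum]; exact Finset.sum_congr rfl fun k _ => by ring
      _ = 0 := by rw [this, mul_zero]
  have hlead : p.coeff n = 1 := by rw [← hdeg]; exact hmonic
  rw [Finset.sum_range_succ, hlead, one_mul] at hrec
  have hn : ‖trigSum x c (t + n * h)‖ ≤
      ∑ k ∈ Finset.range n, (n.choose (n / 2) : ℝ) * ‖trigSum x c (t + k * h)‖ := by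
    rw [eq_neg_of_add_eq_zero_right hrec, norm_neg]
    refine (norm_sum_le _ _).trans (Finset.sum_le_sum fun k _ => ?_)
    rw [norm_mul]
    gcongr
    exact hcoeff k
  rw [← Finset.mul_sum] at hn
  calc _ ≤ ((n.choose (n / 2) : ℝ) * ∑ k ∈ Finset.range n, ‖trigSum x c (t + k * h)‖) ^ 2 := by
        gcongr
    _ = (n.choose (n / 2) : ℝ) ^ 2 * (∑ k ∈ Finset.range n, ‖trigSum x c (t + k * h)‖) ^ 2 := by
        ring
    _ ≤ (n.choose (n / 2) : ℝ) ^ 2 *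
        (n * ∑ k ∈ Finset.range n, ‖trigSum x c (t + k * h)‖ ^ 2) := by
        gcongr
        simpa using sq_sum_le_card_mul_sum_sq (s := Finset.range n)
          (f := fun k : ℕ => ‖trigSum x c (t + k * h)‖)
    _ = _ := by ring

/-- **Turán-type inequality**: the mean square over a long interval is controlled by the mean square
over the unit interval, uniformly in the frequencies. -/
lemma exists_integral_trigSum_le (n : ℕ) (hn : 0 < n) : ∃ C : ℝ, 1 ≤ C ∧
    ∀ (x c : Fin n → ℝ) (k : ℕ), ∫ t in (-(1 / 2 : ℝ))..(1 / 2 + k * (1 / n)),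
      ‖trigSum x c t‖ ^ 2 ≤ C ^ k * ∫ t in (-(1 / 2 : ℝ))..(1 / 2), ‖trigSum x c t‖ ^ 2 := by
  obtain ⟨A, hA, hrec⟩ := exists_recurrence_trigSum n
  refine ⟨1 + A * n, by nlinarith [(Nat.cast_nonneg n : (0:ℝ) ≤ n)], fun x c k => ?_⟩
  have hn0 : (0:ℝ) < n := by exact_mod_cast hn
  have hnn : n * (1 / (n:ℝ)) = 1 := by field_simp
  have hh : (0:ℝ) < 1 / n := by positivity
  set h : ℝ := 1 / n
  have ii := intervalIntegrable_trigSum x c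
  induction k with
  | zero => simp
  | succ k ih =>
    set b : ℝ := 1 / 2 + k * h with hb
    have hb2 : 1 / 2 ≤ b := by rw [hb]; have : 0 ≤ k * h := by positivity
                               linarith
    have hbs : 1 / 2 + ((k + 1 : ℕ) : ℝ) * h = b + h := by rw [hb]; push_cast; ring
    rw [hbs, ← intervalIntegral.integral_add_adjacent_intervals (ii _ b) (ii b _)]
    have hstep : ∫ t in b..(b + h), ‖trigSum x c t‖ ^ 2 ≤
        A * n * ∫ t in (-(1 / 2 : ℝ))..b, ‖trigSum x c t‖ ^ 2 := by
      have e1 : ∫ t in b..(b + h), ‖trigSum x c t‖ ^ 2 =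
          ∫ t in (b - n * h)..(b + h - n * h), ‖trigSum x c (t + n * h)‖ ^ 2 := by
        rw [intervalIntegral.integral_comp_add_right (fun t => ‖trigSum x c t‖ ^ 2)]
        congr 1 <;> ring
      have cont : ∀ k : ℕ, Continuous fun t => ‖trigSum x c (t + k * h)‖ ^ 2 := fun k => by
        have := continuous_trigSum x c
        fun_prop
      have e2 : ∫ t in (b - n * h)..(b + h - n * h), ‖trigSum x c (t + n * h)‖ ^ 2 ≤
          ∫ t in (b - n * h)..(b + h - n * h),
            A * ∑ k ∈ Finset.range n, ‖trigSum x c (t + k * h)‖ ^ 2 := by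
        refine intervalIntegral.integral_mono_on (by linarith) ?_ ?_ fun t _ => hrec x c h t
        · exact (cont n).intervalIntegrable _ _
        · exact (continuous_const.mul (continuous_finsetSum _ fun k _ =>
            cont k)).intervalIntegrable _ _
      rw [e1]
      refine e2.trans ?_
      rw [intervalIntegral.integral_const_mul, intervalIntegral.integral_finsetSum
        fun k _ => (cont k).intervalIntegrable _ _, mul_assoc]
      gcongr
      have e3 : ∀ k ∈ Finset.range n,
          ∫ t in (b - n * h)..(b + h - n * h), ‖trigSum x c (t + k * h)‖ ^ 2 ≤
            ∫ t in (-(1 / 2 : ℝ))..b, ‖trigSum x c t‖ ^ 2 := by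
        intro k hk
        have hk' : (k : ℝ) + 1 ≤ n := by exact_mod_cast Finset.mem_range.mp hk
        have hkh : (k + 1) * h ≤ n * h := by gcongr
        have hk0 : 0 ≤ k * h := by positivity
        rw [intervalIntegral.integral_comp_add_right (fun t => ‖trigSum x c t‖ ^ 2)]
        refine intervalIntegral.integral_mono_interval (by linarith) (by linarith) (by linarith)
          (Filter.Eventually.of_forall fun t => by positivity) (ii _ _)
      refine (Finset.sum_le_sum e3).trans ?_
      simp
    calc _ ≤ (∫ t in (-(1 / 2 : ℝ))..b, ‖trigSum x c t‖ ^ 2) +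
          A * n * ∫ t in (-(1 / 2 : ℝ))..b, ‖trigSum x c t‖ ^ 2 := by gcongr
      _ = (1 + A * n) * ∫ t in (-(1 / 2 : ℝ))..b, ‖trigSum x c t‖ ^ 2 := by ring
      _ ≤ (1 + A * n) * ((1 + A * n) ^ k *
          ∫ t in (-(1 / 2 : ℝ))..(1 / 2), ‖trigSum x c t‖ ^ 2) := by gcongr
      _ = _ := by ring

/-- The exponentials with `δ`-separated frequencies form a Riesz sequence on the unit interval, with
a lower bound depending only on `δ` and on their number. -/
lemma exists_le_integral_trigSum (n : ℕ) (hn : 0 < n) {δ : ℝ} (hδ : 0 < δ) : ∃ l : ℝ, 0 < l ∧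
    ∀ x : Fin n → ℝ, (∀ i j, i ≠ j → δ ≤ |x i - x j|) → ∀ c : Fin n → ℝ,
      l * ∑ i, c i ^ 2 ≤ ∫ t in (-(1 / 2 : ℝ))..(1 / 2), ‖trigSum x c t‖ ^ 2 := by
  obtain ⟨C, hC, hT⟩ := exists_integral_trigSum_le n hn
  have hn0 : (0:ℝ) < n := by exact_mod_cast hn
  obtain ⟨k, hk⟩ := exists_nat_ge (n * (n / δ))
  have hk' : n / δ ≤ k * (1 / n) := by
    rw [mul_one_div, le_div_iff₀ hn0]; linarith
  have hCk : 0 < C ^ k := by positivity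
  refine ⟨1 / C ^ k, by positivity, fun x hx c => ?_⟩
  have h1 := le_integral_norm_trigSum_sq x c hδ hx (-(1 / 2)) (1 / 2 + k * (1 / n))
  have h2 : 1 * ∑ i, c i ^ 2 ≤ (1 / 2 + k * (1 / n) - -(1 / 2) - n / δ) * ∑ i, c i ^ 2 := by
    gcongr
    linarith
  rw [div_mul_eq_mul_div, div_le_iff₀ hCk, mul_comm (∫ t in _.._, _)]
  exact (h2.trans h1).trans (hT x c k)

/-! ### The determinantal density -/

/-- The sine-kernel matrix, whose determinant is `dysonW`. -/
noncomputable def sineMatrix {n : ℕ} (x : E n) : Matrix (Fin n) (Fin n) ℝ :=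
  Matrix.of fun i j => Real.sinc (Real.pi * (x i - x j))

lemma det_sineMatrix {n : ℕ} (x : E n) : (sineMatrix x).det = dysonW n x := rfl

lemma isHermitian_sineMatrix {n : ℕ} (x : E n) : (sineMatrix x).IsHermitian := by
  ext i j
  simp only [sineMatrix, Matrix.conjTranspose_apply, Matrix.of_apply, star_trivial]
  rw [← Real.sinc_neg]
  congr 1
  ring

lemma dotProduct_sineMatrix {n : ℕ} (x : E n) (c : Fin n → ℝ) :
    dotProduct c ((sineMatrix x).mulVec c) =
      ∫ t in (-(1 / 2 : ℝ))..(1 / 2), ‖trigSum (fun i => x i) c t‖ ^ 2 := by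
  rw [integral_norm_trigSum_sq]
  simp only [dotProduct, Matrix.mulVec, Finset.mul_sum, sineMatrix, Matrix.of_apply,
    integral_cos_eq_sinc]
  exact Finset.sum_congr rfl fun i _ => Finset.sum_congr rfl fun j _ => by ring

lemma eigenvalues_sineMatrix {n : ℕ} (x : E n) (i : Fin n) :
    ∃ c : Fin n → ℝ, ∑ j, c j ^ 2 = 1 ∧ (isHermitian_sineMatrix x).eigenvalues i =
      ∫ t in (-(1 / 2 : ℝ))..(1 / 2), ‖trigSum (fun i => x i) c t‖ ^ 2 := by
  refine ⟨(isHermitian_sineMatrix x).eigenvectorBasis i, ?_, ?_⟩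
  · have h := (isHermitian_sineMatrix x).eigenvectorBasis.orthonormal.1 i
    rw [EuclideanSpace.norm_eq, Real.sqrt_eq_one] at h
    simpa using h
  · rw [Matrix.IsHermitian.eigenvalues_eq, ← dotProduct_sineMatrix]
    rfl

lemma eigenvalues_sineMatrix_nonneg {n : ℕ} (x : E n) (i : Fin n) :
    0 ≤ (isHermitian_sineMatrix x).eigenvalues i := by
  obtain ⟨c, -, h⟩ := eigenvalues_sineMatrix x i
  rw [h]
  exact intervalIntegral.integral_nonneg (by norm_num) fun t _ => by positivity

lemma dysonW_eq_prod {n : ℕ} (x : E n) :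
    dysonW n x = ∏ i, (isHermitian_sineMatrix x).eigenvalues i := by
  rw [← det_sineMatrix, (isHermitian_sineMatrix x).det_eq_prod_eigenvalues]
  rfl

lemma dysonW_nonneg {n : ℕ} (x : E n) : 0 ≤ dysonW n x := by
  rw [dysonW_eq_prod]
  exact Finset.prod_nonneg fun i _ => eigenvalues_sineMatrix_nonneg x i

lemma dysonW_le_one {n : ℕ} (x : E n) : dysonW n x ≤ 1 := by
  have htr : ∑ i, (isHermitian_sineMatrix x).eigenvalues i = n := by
    have h := (isHermitian_sineMatrix x).trace_eq_sum_eigenvalues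
    simp only [Matrix.trace, sineMatrix, Matrix.diag_apply, Matrix.of_apply, sub_self, mul_zero,
      Real.sinc_zero, Finset.sum_const, Finset.card_univ, Fintype.card_fin, nsmul_eq_mul,
      mul_one] at h
    exact h.symm
  rw [dysonW_eq_prod]
  -- `∏ λᵢ ≤ ∏ exp(λᵢ - 1) = exp(tr - n) = 1`
  calc _ ≤ ∏ i, Real.exp ((isHermitian_sineMatrix x).eigenvalues i - 1) :=
        Finset.prod_le_prod (fun i _ => eigenvalues_sineMatrix_nonneg x i) fun i _ => by
          linarith [Real.add_one_le_exp ((isHermitian_sineMatrix x).eigenvalues i - 1)]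
    _ = 1 := by rw [← Real.exp_sum, Finset.sum_sub_distrib, htr]; simp

lemma continuous_dysonW (n : ℕ) : Continuous (dysonW n) := by
  unfold dysonW
  refine Continuous.matrix_det (continuous_matrix fun i j => ?_)
  exact Real.continuous_sinc.comp (by fun_prop)

lemma dysonW_perm {n : ℕ} (σ : Equiv.Perm (Fin n)) (x : E n) :
    dysonW n (WithLp.toLp 2 fun i => x (σ i)) = dysonW n x :=
  Matrix.det_submatrix_equiv_self σ (sineMatrix x)

lemma dysonW_congr {n : ℕ} {x y : E n} (h : ∀ i j, x i - x j = y i - y j) :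
    dysonW n x = dysonW n y := by
  unfold dysonW
  congr 1
  ext i j
  simp [h]

/-- The density is bounded below, uniformly, where the points are `δ`-separated. -/
lemma exists_le_dysonW (n : ℕ) (hn : 0 < n) {δ : ℝ} (hδ : 0 < δ) : ∃ l : ℝ, 0 < l ∧
    ∀ x : E n, (∀ i j, i ≠ j → δ ≤ |x i - x j|) → l ≤ dysonW n x := by
  obtain ⟨l, hl, h⟩ := exists_le_integral_trigSum n hn hδ
  refine ⟨l ^ n, by positivity, fun x hx => ?_⟩
  rw [dysonW_eq_prod]
  calc l ^ n = ∏ _i : Fin n, l := by simp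
    _ ≤ _ := Finset.prod_le_prod (fun _ _ => hl.le) fun i _ => by
      obtain ⟨c, hc, he⟩ := eigenvalues_sineMatrix x i
      have := h (fun i => x i) hx c
      rw [hc, mul_one] at this
      rwa [he]

/-! ### Paley–Wiener spaces -/

/-- The Hilbert space `L²(ℝ^d)`. -/
abbrev L2 (d : ℕ) : Type := Lp ℂ 2 (volume : Measure (E d))

section PaleyWiener

variable {d : ℕ} {Ω : Set (E d)}

lemma continuous_neg_innerₗ (d : ℕ) : Continuous fun p : E d × E d => (-innerₗ (E d)) p.1 p.2 :=
  continuous_inner.neg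

lemma norm_sq_eq_integral (g : L2 d) : ‖g‖ ^ 2 = ∫ x, ‖g x‖ ^ 2 := by
  have h := inner_self_eq_norm_sq_to_K (𝕜 := ℂ) g
  rw [L2.inner_def] at h
  simp only [inner_self_eq_norm_sq_to_K] at h
  have h2 : ((∫ x, ‖g x‖ ^ 2 : ℝ) : ℂ) = ((‖g‖ ^ 2 : ℝ) : ℂ) := by
    rw [← integral_complex_ofReal]
    simpa using h
  exact_mod_cast h2.symm

lemma integrable_norm_sq (g : L2 d) : Integrable fun x => ‖g x‖ ^ 2 :=
  (memLp_two_iff_integrable_sq_norm (Lp.aestronglyMeasurable g)).mp (Lp.memLp g)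

/-- `PW Ω` as a subspace of `L²`. -/
noncomputable def pwSubmodule (Ω : Set (E d)) : Submodule ℂ (L2 d) :=
  (LpToLpRestrictCLM (E d) ℂ ℂ volume 2 Ωᶜ ∘L
    ((Lp.fourierTransformₗᵢ (E d) ℂ).toContinuousLinearEquiv : L2 d →L[ℂ] L2 d)).ker

lemma isClosed_pwSubmodule (Ω : Set (E d)) : IsClosed (pwSubmodule Ω : Set (L2 d)) :=
  ContinuousLinearMap.isClosed_ker _

lemma mem_pwSubmodule (hΩ : MeasurableSet Ω) (g : L2 d) : g ∈ pwSubmodule Ω ↔ g ∈ PW Ω := by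
  have e : g ∈ pwSubmodule Ω ↔ LpToLpRestrictCLM (E d) ℂ ℂ volume 2 Ωᶜ (𝓕 g) = 0 := Iff.rfl
  rw [e, Lp.eq_zero_iff_ae_eq_zero]
  have h := LpToLpRestrictCLM_coeFn ℂ Ωᶜ (𝓕 g : L2 d)
  have : (∀ᵐ ξ ∂(volume.restrict Ωᶜ), (𝓕 g : L2 d) ξ = 0) ↔ g ∈ PW Ω :=
    ae_restrict_iff' hΩ.compl
  rw [← this]
  constructor
  · intro h0
    filter_upwards [h, h0] with ξ h1 h2
    rw [← h1, h2]; rfl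
  · intro h0
    filter_upwards [h, h0] with ξ h1 h2
    rw [h1, h2]; rfl

lemma fourier_eq_indicator {g : L2 d} (hg : g ∈ PW Ω) :
    ((𝓕 g : L2 d) : E d → ℂ) =ᵐ[volume] Ω.indicator (𝓕 g : L2 d) := by
  filter_upwards [hg] with ξ h
  by_cases hξ : ξ ∈ Ω
  · rw [Set.indicator_of_mem hξ]
  · rw [Set.indicator_of_notMem hξ, h hξ]

lemma integrable_fourier (hΩ : IsCompact Ω) {g : L2 d} (hg : g ∈ PW Ω) :
    Integrable (𝓕 g : L2 d) := by
  have h1 : IntegrableOn (𝓕 g : L2 d) Ω := by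
    have : IsFiniteMeasure (volume.restrict Ω : Measure (E d)) :=
      isFiniteMeasure_restrict.mpr hΩ.measure_lt_top.ne
    exact ((Lp.memLp (𝓕 g : L2 d)).restrict Ω).integrable (by norm_num)
  exact (h1.integrable_indicator hΩ.measurableSet).congr (fourier_eq_indicator hg).symm

/-- The complex exponential `ξ ↦ exp(2πi ⟨z, ξ⟩)` of frequency `z ∈ ℂ^d`. -/
noncomputable def cplxExp (z : Fin d → ℂ) (ξ : E d) : ℂ :=
  Complex.exp (2 * Real.pi * Complex.I * ∑ i, z i * (ξ i : ℂ))

lemma continuous_cplxExp (z : Fin d → ℂ) : Continuous (cplxExp z) := by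
  unfold cplxExp; fun_prop

lemma cplxExp_toC (x ξ : E d) :
    cplxExp (toC x) ξ = Complex.exp ((2 * Real.pi * inner ℝ ξ x : ℝ) * Complex.I) := by
  unfold cplxExp toC
  congr 1
  rw [PiLp.inner_apply]
  push_cast
  simp only [RCLike.inner_apply, conj_trivial]
  push_cast
  ring

lemma ext_toC (g : L2 d) (x : E d) :
    ext g (toC x) = 𝓕⁻ ((𝓕 g : L2 d) : E d → ℂ) x := by
  rw [Real.fourierInv_eq']
  refine integral_congr_ae (Eventually.of_forall fun ξ => ?_)
  have := cplxExp_toC x ξ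
  unfold cplxExp at this
  simp only [this, smul_eq_mul]
  rw [mul_comm]

/-- The truncated conjugate exponential, which represents the point evaluation at `z` on the Fourier
side. -/
noncomputable def evalFun (Ω : Set (E d)) (z : Fin d → ℂ) : E d → ℂ :=
  Ω.indicator fun ξ => conj (cplxExp z ξ)

lemma memLp_evalFun (hΩ : IsCompact Ω) (z : Fin d → ℂ) : MemLp (evalFun Ω z) 2 := by
  unfold evalFun
  rw [memLp_indicator_iff_restrict hΩ.measurableSet]
  have : IsFiniteMeasure (volume.restrict Ω : Measure (E d)) :=
    isFiniteMeasure_restrict.mpr hΩ.measure_lt_top.ne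
  have hc : Continuous fun ξ : E d => conj (cplxExp z ξ) :=
    Complex.continuous_conj.comp (continuous_cplxExp z)
  obtain ⟨C, hC⟩ := hΩ.exists_bound_of_continuousOn hc.continuousOn
  exact MemLp.of_bound hc.aestronglyMeasurable C
    ((ae_restrict_iff' hΩ.measurableSet).mpr (Eventually.of_forall hC))

lemma ext_eq_inner (hΩ : IsCompact Ω) {g : L2 d} (hg : g ∈ PW Ω) (z : Fin d → ℂ) :
    ext g z = inner ℂ ((memLp_evalFun hΩ z).toLp _) (𝓕 g) := by
  rw [L2.inner_def]
  refine integral_congr_ae ?_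
  filter_upwards [(memLp_evalFun hΩ z).coeFn_toLp, hg] with ξ h1 h2
  rw [h1, RCLike.inner_apply]
  by_cases hξ : ξ ∈ Ω
  · simp [evalFun, Set.indicator_of_mem hξ, cplxExp]
  · simp [h2 hξ]

/-- The point evaluation at `z` on `PW Ω`, as a vector of `L²`. -/
noncomputable def evalVec (hΩ : IsCompact Ω) (z : Fin d → ℂ) : L2 d :=
  𝓕⁻ ((memLp_evalFun hΩ z).toLp _ : L2 d)

lemma ext_eq_inner_evalVec (hΩ : IsCompact Ω) {g : L2 d} (hg : g ∈ PW Ω) (z : Fin d → ℂ) :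
    ext g z = inner ℂ (evalVec hΩ z) g := by
  rw [ext_eq_inner hΩ hg, ← Lp.inner_fourier_eq (evalVec hΩ z) g, evalVec,
    FourierTransform.fourier_fourierInv_eq]

lemma norm_ext_sub_le (hΩ : IsCompact Ω) : ∃ C : ℝ, ∀ g ∈ PW Ω, ∀ x : E d,
    ‖ext g (toC x) - ext g (toC 0)‖ ≤ C * ‖x‖ * ‖g‖ := by
  obtain ⟨R, hR⟩ := hΩ.isBounded.exists_norm_le
  have hfin : volume Ω ≠ ⊤ := hΩ.measure_lt_top.ne
  refine ⟨2 * Real.pi * R * Real.sqrt (volume.real Ω), fun g hg x => ?_⟩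
  rw [ext_eq_inner hΩ hg, ext_eq_inner hΩ hg, ← inner_sub_left, ← Lp.norm_fourier_eq g]
  refine (norm_inner_le_norm _ _).trans ?_
  gcongr
  set u : L2 d := (memLp_evalFun hΩ (toC x)).toLp _ - (memLp_evalFun hΩ (toC 0)).toLp _ with hu
  have hbound : ∀ᵐ ξ, ‖u ξ‖ ^ 2 ≤ Ω.indicator (fun _ => (2 * Real.pi * R * ‖x‖) ^ 2) ξ := by
    filter_upwards [Lp.coeFn_sub ((memLp_evalFun hΩ (toC x)).toLp _)
      ((memLp_evalFun hΩ (toC 0)).toLp _), (memLp_evalFun hΩ (toC x)).coeFn_toLp,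
      (memLp_evalFun hΩ (toC (0 : E d))).coeFn_toLp] with ξ h1 h2 h3
    rw [hu, h1, Pi.sub_apply, h2, h3]
    by_cases hξ : ξ ∈ Ω
    · simp only [evalFun, Set.indicator_of_mem hξ]
      rw [← map_sub, RCLike.norm_conj, cplxExp_toC, cplxExp_toC, inner_zero_right]
      simp only [mul_zero, Complex.ofReal_zero, zero_mul, Complex.exp_zero]
      have h4 : ‖Complex.exp ((2 * Real.pi * inner ℝ ξ x : ℝ) * Complex.I) - 1‖ ≤
          ‖2 * Real.pi * inner ℝ ξ x‖ := by
        rw [mul_comm]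
        exact Real.norm_exp_I_mul_ofReal_sub_one_le
      have h5 : ‖2 * Real.pi * inner ℝ ξ x‖ ≤ 2 * Real.pi * R * ‖x‖ := by
        rw [norm_mul, Real.norm_of_nonneg Real.two_pi_pos.le, mul_assoc (2 * Real.pi)]
        exact mul_le_mul_of_nonneg_left ((norm_inner_le_norm (𝕜 := ℝ) ξ x).trans
          (mul_le_mul_of_nonneg_right (hR ξ hξ) (norm_nonneg _))) Real.two_pi_pos.le
      gcongr
      exact h4.trans h5
    · simp [evalFun, Set.indicator_of_notMem hξ]
  have hsq : ‖u‖ ^ 2 ≤ (2 * Real.pi * R * Real.sqrt (volume.real Ω) * ‖x‖) ^ 2 := by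
    rw [norm_sq_eq_integral]
    refine (integral_mono_ae (integrable_norm_sq u) ?_ hbound).trans ?_
    · exact (integrable_indicator_iff hΩ.measurableSet).mpr (integrableOn_const hfin)
    · rw [integral_indicator hΩ.measurableSet, setIntegral_const, smul_eq_mul]
      rw [show (2 * Real.pi * R * Real.sqrt (volume.real Ω) * ‖x‖) ^ 2 =
        Real.sqrt (volume.real Ω) ^ 2 * (2 * Real.pi * R * ‖x‖) ^ 2 by ring,
        Real.sq_sqrt measureReal_nonneg]
  by_cases hne : Ω.Nonempty
  · obtain ⟨ξ, hξ⟩ := hne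
    have hR0 : 0 ≤ R := (norm_nonneg _).trans (hR ξ hξ)
    exact le_of_sq_le_sq hsq (by positivity)
  · rw [Set.not_nonempty_iff_eq_empty] at hne
    subst hne
    simp at hsq ⊢
    exact hsq

/-- Fourier inversion in `L² ∩ L¹`. -/
lemma fourierInv_ae_eq (h : L2 d) (hi : Integrable h) :
    ((𝓕⁻ h : L2 d) : E d → ℂ) =ᵐ[volume] 𝓕⁻ (h : E d → ℂ) := by
  have hcont : Continuous (𝓕⁻ (h : E d → ℂ)) :=
    VectorFourier.fourierIntegral_continuous Real.continuous_fourierChar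
      (continuous_neg_innerₗ d) hi
  refine ae_eq_of_integral_contDiff_smul_eq ((Lp.memLp _).locallyIntegrable (by norm_num))
    hcont.locallyIntegrable fun g hg hgc => ?_
  have hg₁ : HasCompactSupport (Complex.ofRealCLM ∘ g) := hgc.comp_left rfl
  have hg₂ : ContDiff ℝ ∞ (Complex.ofRealCLM ∘ g) := by fun_prop
  set ψ : 𝓢(E d, ℂ) := hg₁.toSchwartzMap hg₂ with hψ
  have hψx : ∀ x, ψ x = (g x : ℂ) := fun x => rfl
  have h1 := congrArg (fun T : 𝓢'(E d, ℂ) => T ψ) (Lp.fourierInv_toTemperedDistribution_eq h)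
  simp only [TemperedDistribution.fourierInv_apply, Lp.toTemperedDistribution_apply,
    SchwartzMap.fourierInv_coe] at h1
  have h2 := VectorFourier.integral_fourierIntegral_smul_eq_flip (L := -innerₗ (E d))
    (μ := volume) (ν := volume)
    Real.continuous_fourierChar (continuous_neg_innerₗ d) ψ.integrable hi
  have h3 : (-innerₗ (E d)).flip = -innerₗ (E d) := by
    ext x y; simp [real_inner_comm]
  rw [h3] at h2
  have h4 : ∫ x, g x • (𝓕⁻ h : L2 d) x = ∫ x, ψ x • (𝓕⁻ h : L2 d) x := by
    simp [hψx]
  have h5 : ∫ x, g x • 𝓕⁻ (h : E d → ℂ) x = ∫ x, ψ x • 𝓕⁻ (h : E d → ℂ) x := by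
    simp [hψx]
  rw [h4, h5, ← h1]
  exact h2

/-- An element of `PW Ω` agrees almost everywhere with its entire extension. -/
lemma ext_toC_ae_eq (hΩ : IsCompact Ω) {g : L2 d} (hg : g ∈ PW Ω) :
    (fun x => ext g (toC x)) =ᵐ[volume] g := by
  have h := fourierInv_ae_eq _ (integrable_fourier hΩ hg)
  rw [FourierTransform.fourierInv_fourier_eq] at h
  filter_upwards [h] with x hx
  rw [ext_toC, hx]

lemma continuous_ext_toC (hΩ : IsCompact Ω) {g : L2 d} (hg : g ∈ PW Ω) :
    Continuous fun x => ext g (toC x) := by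
  simp only [ext_toC]
  exact VectorFourier.fourierIntegral_continuous Real.continuous_fourierChar
      (continuous_neg_innerₗ d) (integrable_fourier hΩ hg)

/-- A compactly supported smooth function on the Fourier side gives an element of the Paley–Wiener
space, which is a Schwartz function. -/
lemma toLp_fourierInv_mem_PW {φ : 𝓢(E d, ℂ)} (hφ : tsupport φ ⊆ Ω) :
    ((𝓕⁻ φ : 𝓢(E d, ℂ)).toLp 2 : L2 d) ∈ PW Ω := by
  unfold PW
  rw [Set.mem_ofPred_eq, SchwartzMap.toLp_fourier_eq, FourierTransform.fourier_fourierInv_eq]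
  filter_upwards [φ.coeFn_toLp 2 volume] with ξ h hξ
  rw [h]
  exact image_eq_zero_of_notMem_tsupport fun h' => hξ (hφ h')

lemma ext_toLp_fourierInv (φ : 𝓢(E d, ℂ)) (x : E d) :
    ext ((𝓕⁻ φ : 𝓢(E d, ℂ)).toLp 2 : L2 d) (toC x) = (𝓕⁻ φ : 𝓢(E d, ℂ)) x := by
  rw [ext_toC, SchwartzMap.toLp_fourier_eq, FourierTransform.fourier_fourierInv_eq,
    SchwartzMap.fourierInv_coe]
  exact Real.fourierInv_congr_ae (φ.coeFn_toLp 2 volume) x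

end PaleyWiener

/-! ### Equivalence of the weighted norm -/

section NormEquivalence

variable {d : ℕ} {Ω : Set (E d)}

/-- The mass of an integrable function in a slab is small, uniformly over all parallel slabs, if the
slab is thin. -/
lemma exists_lintegral_slab_lt {φ : E d → ENNReal} (hfin : ∫⁻ x, φ x ≠ ⊤)
    (l : E d →ₗ[ℝ] ℝ) (hl : l ≠ 0) {ε : ENNReal} (hε : ε ≠ 0) :
    ∃ δ : ℝ, 0 < δ ∧ ∀ t : ℝ, ∫⁻ x in {x | |l x + t| < δ}, φ x < ε := by
  have hlm : Measurable l := l.continuous_of_finiteDimensional.measurable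
  obtain ⟨c, -, hc⟩ := l.exists_map_addHaar_eq_smul_addHaar volume volume
    (LinearMap.surjective hl)
  set μ : Measure ℝ := (volume.withDensity φ).map l with hμ
  have : IsFiniteMeasure (volume.withDensity φ) := isFiniteMeasure_withDensity hfin
  have hac : μ ≪ volume :=
    ((withDensity_absolutelyContinuous volume φ).map hlm).trans (by
      rw [hc]; exact Measure.smul_absolutelyContinuous)
  have hd : volume.withDensity (μ.rnDeriv volume) = μ := Measure.withDensity_rnDeriv_eq _ _ hac
  have hfin' : ∫⁻ x, μ.rnDeriv volume x ≠ ⊤ := (Measure.lintegral_rnDeriv_lt_top μ volume).ne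
  obtain ⟨η, hη, h⟩ := exists_pos_setLIntegral_lt_of_measure_lt hfin' hε
  obtain ⟨r, hr0, hr⟩ := ENNReal.lt_iff_exists_nnreal_btwn.mp hη
  have hr0' : 0 < r := by exact_mod_cast hr0
  refine ⟨r / 2, by positivity, fun t => ?_⟩
  have hset : {x | |l x + t| < (r : ℝ) / 2} = l ⁻¹' Metric.ball (-t) (r / 2) := by
    ext x
    simp [Real.dist_eq]
  have hball : volume (Metric.ball (-t) ((r : ℝ) / 2)) < η := by
    rw [Real.volume_ball, mul_div_cancel₀ _ (by norm_num : (2:ℝ) ≠ 0)]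
    simpa using hr
  have hms : MeasurableSet (l ⁻¹' Metric.ball (-t) ((r : ℝ) / 2)) := hlm measurableSet_ball
  have := h _ hball
  rw [← withDensity_apply _ measurableSet_ball, hd, hμ, Measure.map_apply hlm measurableSet_ball,
    withDensity_apply _ hms] at this
  rwa [hset]

/-- Functions in `PW Ω` are reproduced by convolution with a fixed Schwartz function. -/
lemma exists_convolution_eq (hΩ : IsCompact Ω) : ∃ φ : 𝓢(E d, ℂ), ∀ g ∈ PW Ω, ∀ x : E d,
    ext g (toC x) = ∫ y, φ y * ext g (toC (x - y)) := by
  obtain ⟨R, hR0, hR⟩ := hΩ.isBounded.exists_pos_norm_le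
  let b : ContDiffBump (0 : E d) := ⟨R, R + 1, hR0, by linarith⟩
  have hb₁ : HasCompactSupport (Complex.ofRealCLM ∘ b) := b.hasCompactSupport.comp_left rfl
  have hb₂ : ContDiff ℝ ∞ (Complex.ofRealCLM ∘ b) := Complex.ofRealCLM.contDiff.comp b.contDiff
  set χ : 𝓢(E d, ℂ) := hb₁.toSchwartzMap hb₂
  have hχ : ∀ ξ ∈ Ω, χ ξ = 1 := by
    intro ξ hξ
    have : b ξ = 1 := b.one_of_mem_closedBall (by simpa using hR ξ hξ)
    change ((b ξ : ℝ) : ℂ) = 1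
    rw [this, Complex.ofReal_one]
  refine ⟨𝓕⁻ χ, fun g hg x => ?_⟩
  have hi := integrable_fourier hΩ hg
  set H : E d → ℂ := fun ξ => Real.fourierChar (inner ℝ ξ x) • (𝓕 g : L2 d) ξ with hH
  have hHi : Integrable H := by
    have := (VectorFourier.fourierIntegral_convergent_iff Real.continuous_fourierChar
      (continuous_neg_innerₗ d) x).2 hi
    simpa [hH] using this
  have h1 : ∀ y, ext g (toC (x - y)) = 𝓕 H y := by
    intro y
    rw [ext_toC, Real.fourierInv_eq, Real.fourier_eq]
    refine integral_congr_ae (Eventually.of_forall fun ξ => ?_)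
    simp only [hH]
    rw [smul_smul, ← AddChar.map_add_eq_mul, inner_sub_right, neg_add_eq_sub]
  have h2 := VectorFourier.integral_fourierIntegral_smul_eq_flip (L := innerₗ (E d))
    (μ := volume) (ν := volume)
    Real.continuous_fourierChar continuous_inner (𝓕⁻ χ : 𝓢(E d, ℂ)).integrable hHi
  have h3 : ∫ ξ, χ ξ • H ξ = ∫ y, (𝓕⁻ χ : 𝓢(E d, ℂ)) y • 𝓕 H y := by
    have e : (𝓕 ((𝓕⁻ χ : 𝓢(E d, ℂ)) : E d → ℂ)) = χ := by
      rw [← SchwartzMap.fourier_coe, FourierTransform.fourier_fourierInv_eq]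
    have e' : (innerₗ (E d)).flip = innerₗ (E d) := by
      ext x y; simp
    rw [e'] at h2
    rw [← e]
    exact h2
  simp only [h1, smul_eq_mul] at h3 ⊢
  rw [← h3, ext_toC, Real.fourierInv_eq]
  refine integral_congr_ae ?_
  filter_upwards [hg] with ξ hξ
  by_cases hm : ξ ∈ Ω
  · rw [hχ ξ hm, one_mul]
  · simp [hH, hξ hm]

/-- The mass of a function of `PW Ω` in a thin slab is a small part of its total mass. -/
lemma exists_lintegral_slab_le (hΩ : IsCompact Ω) (l : E d →ₗ[ℝ] ℝ) (hl : l ≠ 0)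
    {ε : ENNReal} (hε : ε ≠ 0) : ∃ δ : ℝ, 0 < δ ∧ ∀ g ∈ PW Ω,
      ∫⁻ x in {x | |l x| < δ}, ‖g x‖ₑ ^ 2 ≤ ε * ∫⁻ x, ‖g x‖ₑ ^ 2 := by
  obtain ⟨φ, hφ⟩ := exists_convolution_eq hΩ
  have hφm : Measurable fun x => ‖φ x‖ₑ := φ.continuous.measurable.enorm
  set M : ENNReal := ∫⁻ x, ‖φ x‖ₑ with hM
  have hMfin : M ≠ ⊤ := φ.integrable.2.ne
  obtain ⟨δ, hδ, hslab⟩ := exists_lintegral_slab_lt hMfin l hl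
    (ε := ε / (M + 1)) (ENNReal.div_ne_zero.mpr ⟨hε, by finiteness⟩)
  have hMε : M * (ε / (M + 1)) ≤ ε := by
    rw [← mul_div_assoc]
    refine ENNReal.div_le_of_le_mul ?_
    rw [mul_comm]
    gcongr
    exact le_self_add
  refine ⟨δ, hδ, fun g hg => ?_⟩
  set γ : E d → ℂ := fun x => ext g (toC x) with hγ
  have hγm : Measurable fun x => ‖γ x‖ₑ := (continuous_ext_toC hΩ hg).measurable.enorm
  have hae : (fun x => ‖g x‖ₑ ^ 2) =ᵐ[volume] fun x => ‖γ x‖ₑ ^ 2 := by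
    filter_upwards [ext_toC_ae_eq hΩ hg] with x hx
    rw [← hx]
  rw [lintegral_congr_ae hae, lintegral_congr_ae (ae_restrict_of_ae hae)]
  have hpt : ∀ x, ‖γ x‖ₑ ^ 2 ≤ M * ∫⁻ y, ‖φ (x - y)‖ₑ * ‖γ y‖ₑ ^ 2 := by
    intro x
    have h1 : ‖γ x‖ₑ ≤ ∫⁻ y, ‖φ y‖ₑ * ‖γ (x - y)‖ₑ := by
      have e : γ x = ∫ y, φ y * γ (x - y) := hφ g hg x
      rw [e]
      refine (enorm_integral_le_lintegral_enorm _).trans (le_of_eq ?_)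
      simp only [enorm_mul]
    have hm2 : Measurable fun y => ‖γ (x - y)‖ₑ := hγm.comp (measurable_const.sub measurable_id)
    -- Cauchy–Schwarz for the measure `|φ(y)| dy`
    have h2 : ∫⁻ y, ‖φ y‖ₑ * ‖γ (x - y)‖ₑ ≤
        M ^ (1 / 2 : ℝ) * (∫⁻ y, ‖φ y‖ₑ * ‖γ (x - y)‖ₑ ^ 2) ^ (1 / 2 : ℝ) := by
      have h := ENNReal.lintegral_mul_le_Lp_mul_Lq (volume.withDensity fun y => ‖φ y‖ₑ)
        (Real.HolderConjugate.two_two) (f := fun _ => 1) (g := fun y => ‖γ (x - y)‖ₑ)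
        aemeasurable_const hm2.aemeasurable
      simp only [Pi.mul_apply, one_mul, ENNReal.rpow_two] at h
      rw [lintegral_withDensity_eq_lintegral_mul _ hφm hm2,
        lintegral_withDensity_eq_lintegral_mul _ hφm measurable_const,
        lintegral_withDensity_eq_lintegral_mul _ hφm (hm2.pow_const 2)] at h
      simpa only [Pi.mul_apply, one_pow, mul_one] using h
    have h3 : ∫⁻ y, ‖φ (x - y)‖ₑ * ‖γ y‖ₑ ^ 2 = ∫⁻ y, ‖φ y‖ₑ * ‖γ (x - y)‖ₑ ^ 2 := by
      rw [← lintegral_sub_left_eq_self (μ := (volume : Measure (E d)))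
        (fun y => ‖φ y‖ₑ * ‖γ (x - y)‖ₑ ^ 2) x]
      simp only [sub_sub_cancel]
    rw [h3]
    calc ‖γ x‖ₑ ^ 2 ≤ (M ^ (1 / 2 : ℝ) *
          (∫⁻ y, ‖φ y‖ₑ * ‖γ (x - y)‖ₑ ^ 2) ^ (1 / 2 : ℝ)) ^ 2 := by
          gcongr; exact h1.trans h2
      _ = _ := by
          rw [mul_pow, ← ENNReal.rpow_natCast, ← ENNReal.rpow_natCast, ← ENNReal.rpow_mul,
            ← ENNReal.rpow_mul]
          norm_num
  have hlm : Measurable l := l.continuous_of_finiteDimensional.measurable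
  set A : Set (E d) := {x | |l x| < δ} with hA
  have hAm : MeasurableSet A := measurableSet_lt hlm.abs measurable_const
  have hφ2 : Measurable fun p : E d × E d => ‖φ (p.1 - p.2)‖ₑ * ‖γ p.2‖ₑ ^ 2 :=
    (hφm.comp (measurable_fst.sub measurable_snd)).mul
      ((hγm.comp measurable_snd).pow_const 2)
  have htrans : ∀ y, ∫⁻ x in A, ‖φ (x - y)‖ₑ ≤ ε / (M + 1) := by
    intro y
    have e : ∫⁻ x in A, ‖φ (x - y)‖ₑ = ∫⁻ x in {x | |l x + l y| < δ}, ‖φ x‖ₑ := by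
      rw [← lintegral_indicator hAm, ← lintegral_indicator
        (measurableSet_lt (hlm.add_const _).abs measurable_const),
        ← lintegral_add_right_eq_self (μ := (volume : Measure (E d)))
          (A.indicator fun x => ‖φ (x - y)‖ₑ) y]
      refine lintegral_congr fun x => ?_
      simp [Set.indicator, hA]
    rw [e]
    exact (hslab _).le
  calc ∫⁻ x in A, ‖γ x‖ₑ ^ 2 ≤ ∫⁻ x in A, M * ∫⁻ y, ‖φ (x - y)‖ₑ * ‖γ y‖ₑ ^ 2 :=
        lintegral_mono hpt
    _ = M * ∫⁻ y, ∫⁻ x in A, ‖φ (x - y)‖ₑ * ‖γ y‖ₑ ^ 2 := by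
        rw [lintegral_const_mul' _ _ hMfin, lintegral_lintegral_swap hφ2.aemeasurable]
    _ = M * ∫⁻ y, (∫⁻ x in A, ‖φ (x - y)‖ₑ) * ‖γ y‖ₑ ^ 2 := by
        congr 1
        refine lintegral_congr fun y => ?_
        rw [lintegral_mul_const' _ _ (by finiteness)]
    _ ≤ M * ∫⁻ y, ε / (M + 1) * ‖γ y‖ₑ ^ 2 := by
        gcongr with y
        exact htrans y
    _ = (M * (ε / (M + 1))) * ∫⁻ y, ‖γ y‖ₑ ^ 2 := by
        rw [lintegral_const_mul _ (hγm.pow_const 2), mul_assoc]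
    _ ≤ _ := by gcongr

lemma setIntegral_norm_sq_eq (g : L2 d) (A : Set (E d)) :
    ∫ x in A, ‖g x‖ ^ 2 = (∫⁻ x in A, ‖g x‖ₑ ^ 2).toReal := by
  rw [integral_eq_lintegral_of_nonneg_ae (Eventually.of_forall fun x => by positivity)
    (integrable_norm_sq g).aestronglyMeasurable.restrict]
  congr 1
  refine lintegral_congr fun x => ?_
  rw [ENNReal.ofReal_pow (norm_nonneg _), ofReal_norm]

/-- At most half of the mass of a function of `PW Ω` lies in a union of thin slabs. -/
lemma exists_setIntegral_iUnion_slab_le (hΩ : IsCompact Ω) {ι : Type*} [Fintype ι]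
    (l : ι → E d →ₗ[ℝ] ℝ) (hl : ∀ i, l i ≠ 0) : ∃ δ : ℝ, 0 < δ ∧ ∀ g ∈ PW Ω,
      ∫ x in ⋃ i, {x | |l i x| < δ}, ‖g x‖ ^ 2 ≤ 1 / 2 * ‖g‖ ^ 2 := by
  set ε : ENNReal := 1 / (2 * (Fintype.card ι + 1)) with hε
  have hε0 : ε ≠ 0 := ENNReal.div_ne_zero.mpr ⟨one_ne_zero, by finiteness⟩
  choose δ hδ h using fun i => exists_lintegral_slab_le hΩ (l i) (hl i) hε0
  obtain ⟨δ₀, hδ₀, hle⟩ : ∃ δ₀ : ℝ, 0 < δ₀ ∧ ∀ i, δ₀ ≤ δ i := by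
    by_cases hι : Nonempty ι
    · refine ⟨Finset.univ.inf' Finset.univ_nonempty δ, ?_, fun i =>
        Finset.inf'_le _ (Finset.mem_univ i)⟩
      rw [Finset.lt_inf'_iff]
      exact fun i _ => hδ i
    · exact ⟨1, one_pos, fun i => (hι ⟨i⟩).elim⟩
  refine ⟨δ₀, hδ₀, fun g hg => ?_⟩
  have hfin : ∫⁻ x, ‖g x‖ₑ ^ 2 ≠ ⊤ := by
    have := (integrable_norm_sq g).2
    refine (lt_of_eq_of_lt (lintegral_congr fun x => ?_) this).ne
    simp
  have hnorm : ‖g‖ ^ 2 = (∫⁻ x, ‖g x‖ₑ ^ 2).toReal := by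
    rw [norm_sq_eq_integral, ← setIntegral_univ, setIntegral_norm_sq_eq, setLIntegral_univ]
  rw [setIntegral_norm_sq_eq, hnorm]
  have hmain : ∫⁻ x in ⋃ i, {x | |l i x| < δ₀}, ‖g x‖ₑ ^ 2 ≤ 1 / 2 * ∫⁻ x, ‖g x‖ₑ ^ 2 := by
    calc _ ≤ ∑' i, ∫⁻ x in {x | |l i x| < δ₀}, ‖g x‖ₑ ^ 2 := lintegral_iUnion_le _ _
      _ = ∑ i, ∫⁻ x in {x | |l i x| < δ₀}, ‖g x‖ₑ ^ 2 := tsum_fintype _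
      _ ≤ ∑ _i : ι, ε * ∫⁻ x, ‖g x‖ₑ ^ 2 := by
          refine Finset.sum_le_sum fun i _ => le_trans (lintegral_mono_set ?_) (h i g hg)
          intro x hx
          exact lt_of_lt_of_le hx (hle i)
      _ = (Fintype.card ι * ε) * ∫⁻ x, ‖g x‖ₑ ^ 2 := by
          simp [Finset.card_univ, mul_assoc]
      _ ≤ _ := by
          gcongr
          rw [hε, ← mul_div_assoc, mul_one]
          refine ENNReal.div_le_of_le_mul ?_
          rw [← mul_assoc, ENNReal.div_mul_cancel (by norm_num) (by norm_num), one_mul]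
          exact le_self_add
  have := ENNReal.toReal_mono (by finiteness) hmain
  rw [ENNReal.toReal_mul] at this
  simpa using this

/-- The inclusion `ℝ^d → ℝ^{d+1}`, `x ↦ (x, 0)`. -/
noncomputable def snocZero (d : ℕ) : E d →ₗ[ℝ] E (d + 1) where
  toFun x := WithLp.toLp 2 (Fin.snoc (α := fun _ => ℝ) x 0)
  map_add' x y := by
    ext i
    refine Fin.lastCases ?_ (fun j => ?_) i <;> simp
  map_smul' a x := by
    ext i
    refine Fin.lastCases ?_ (fun j => ?_) i <;> simp

@[simp] lemma snocZero_castSucc (x : E d) (i : Fin d) : snocZero d x i.castSucc = x i := by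
  simp [snocZero]

@[simp] lemma snocZero_last (x : E d) : snocZero d x (Fin.last d) = 0 := by
  simp [snocZero]

lemma weight_eq (x : E d) : weight d x = dysonW (d + 1) (snocZero d x) := rfl

lemma weight_nonneg (x : E d) : 0 ≤ weight d x := dysonW_nonneg _

lemma weight_le_one (x : E d) : weight d x ≤ 1 := dysonW_le_one _

lemma continuous_weight (d : ℕ) : Continuous (weight d) :=
  (continuous_dysonW (d + 1)).comp (snocZero d).continuous_of_finiteDimensional

/-- The coordinate differences `x ↦ xᵢ - xⱼ` on `ℝ^d`, where the last of the `d + 1` coordinates is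
set to `0`. -/
noncomputable def coordDiff (p : Fin (d + 1) × Fin (d + 1)) : E d →ₗ[ℝ] ℝ :=
  ((EuclideanSpace.proj p.1 : E (d + 1) →L[ℝ] ℝ).toLinearMap -
    (EuclideanSpace.proj p.2 : E (d + 1) →L[ℝ] ℝ).toLinearMap) ∘ₗ snocZero d

lemma coordDiff_apply (p : Fin (d + 1) × Fin (d + 1)) (x : E d) :
    coordDiff p x = snocZero d x p.1 - snocZero d x p.2 := rfl

lemma coordDiff_ne_zero {i j : Fin (d + 1)} (hij : i ≠ j) : coordDiff (i, j) ≠ 0 := by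
  have key : ∀ (k : Fin d) (j : Fin (d + 1)), j ≠ k.castSucc →
      snocZero d (EuclideanSpace.single k 1) j = 0 := by
    intro k j
    refine Fin.lastCases (fun _ => snocZero_last _) (fun j' h => ?_) j
    rw [snocZero_castSucc]
    have : j' ≠ k := fun h' => h (by rw [h'])
    simp [this]
  intro h0
  rcases Fin.eq_castSucc_or_eq_last i with ⟨k, rfl⟩ | rfl
  · have := LinearMap.congr_fun h0 (EuclideanSpace.single k 1)
    rw [coordDiff_apply, key k j hij.symm] at this
    simp at this
  · rcases Fin.eq_castSucc_or_eq_last j with ⟨k, rfl⟩ | rfl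
    · have := LinearMap.congr_fun h0 (EuclideanSpace.single k 1)
      rw [coordDiff_apply, key k _ hij] at this
      simp at this
    · exact hij rfl

lemma integrable_norm_sq_mul_weight (g : L2 d) : Integrable fun x => ‖g x‖ ^ 2 * weight d x := by
  refine (integrable_norm_sq g).mono
    (((Lp.aestronglyMeasurable g).norm.pow 2).mul (continuous_weight d).aestronglyMeasurable)
    (Eventually.of_forall fun x => ?_)
  rw [norm_mul, Real.norm_of_nonneg (weight_nonneg x)]
  exact mul_le_of_le_one_right (norm_nonneg _) (weight_le_one x)

lemma integral_norm_sq_mul_weight_le (g : L2 d) : ∫ x, ‖g x‖ ^ 2 * weight d x ≤ ‖g‖ ^ 2 := by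
  rw [norm_sq_eq_integral]
  refine integral_mono (integrable_norm_sq_mul_weight g) (integrable_norm_sq g) fun x => ?_
  exact mul_le_of_le_one_right (by positivity) (weight_le_one x)

/-- The weighted norm is bounded below on `PW Ω`: the weight is small only in thin slabs around the
hyperplanes `xᵢ = xⱼ`, which carry at most half of the mass. -/
lemma exists_le_integral_norm_sq_mul_weight (hΩ : IsCompact Ω) : ∃ a : ℝ, 0 < a ∧ ∀ g ∈ PW Ω,
    a * ‖g‖ ^ 2 ≤ ∫ x, ‖g x‖ ^ 2 * weight d x := by
  obtain ⟨δ, hδ, hslab⟩ := exists_setIntegral_iUnion_slab_le hΩ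
    (fun p : {p : Fin (d + 1) × Fin (d + 1) // p.1 ≠ p.2} => coordDiff p.1)
    (fun p => coordDiff_ne_zero p.2)
  obtain ⟨l, hl, hW⟩ := exists_le_dysonW (d + 1) d.succ_pos hδ
  refine ⟨l * (1 / 2), by positivity, fun g hg => ?_⟩
  set A : Set (E d) := ⋃ p : {p : Fin (d + 1) × Fin (d + 1) // p.1 ≠ p.2},
    {x | |coordDiff p.1 x| < δ} with hA
  have hAm : MeasurableSet A := MeasurableSet.iUnion fun p =>
    measurableSet_lt (coordDiff p.1).continuous_of_finiteDimensional.measurable.abs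
      measurable_const
  have hlow : ∀ x ∈ Aᶜ, l ≤ weight d x := by
    intro x hx
    refine hW _ fun i j hij => ?_
    by_contra hlt
    exact hx (Set.mem_iUnion.mpr ⟨⟨(i, j), hij⟩, not_le.mp hlt⟩)
  have hsplit := integral_add_compl hAm (integrable_norm_sq g)
  rw [← norm_sq_eq_integral] at hsplit
  have h1 := hslab g hg
  calc l * (1 / 2) * ‖g‖ ^ 2 ≤ l * ∫ x in Aᶜ, ‖g x‖ ^ 2 := by
        rw [mul_assoc]
        gcongr
        linarith
    _ = ∫ x in Aᶜ, l * ‖g x‖ ^ 2 := (integral_const_mul _ _).symm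
    _ ≤ ∫ x in Aᶜ, ‖g x‖ ^ 2 * weight d x := by
        refine setIntegral_mono_on ((integrable_norm_sq g).const_mul l).integrableOn
          (integrable_norm_sq_mul_weight g).integrableOn hAm.compl fun x hx => ?_
        rw [mul_comm]
        gcongr
        exact hlow x hx
    _ ≤ ∫ x, ‖g x‖ ^ 2 * weight d x :=
        setIntegral_le_integral (integrable_norm_sq_mul_weight g)
          (Eventually.of_forall fun x => mul_nonneg (by positivity) (weight_nonneg x))

end NormEquivalence

/-! ### The reproducing kernel -/

section Kernel

variable {d : ℕ} {Ω : Set (E d)}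

lemma memLp_weight_mul (g : L2 d) : MemLp (fun x => (weight d x : ℂ) * g x) 2 := by
  refine (Lp.memLp g).of_le ?_ (Eventually.of_forall fun x => ?_)
  · exact (Complex.continuous_ofReal.comp (continuous_weight d)).aestronglyMeasurable.mul
      (Lp.aestronglyMeasurable g)
  · rw [norm_mul, Complex.norm_real, Real.norm_of_nonneg (weight_nonneg x)]
    exact mul_le_of_le_one_left (norm_nonneg _) (weight_le_one x)

/-- Multiplication by the weight, as an operator on `L²`. -/
noncomputable def weightMul (d : ℕ) : L2 d →L[ℂ] L2 d :=
  LinearMap.mkContinuous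
    { toFun := fun g => (memLp_weight_mul g).toLp _
      map_add' := fun g h => by
        refine Lp.ext ?_
        filter_upwards [(memLp_weight_mul (g + h)).coeFn_toLp, (memLp_weight_mul g).coeFn_toLp,
          (memLp_weight_mul h).coeFn_toLp, Lp.coeFn_add g h,
          Lp.coeFn_add ((memLp_weight_mul g).toLp _) ((memLp_weight_mul h).toLp _)]
          with x h1 h2 h3 h4 h5
        rw [h1, h5, Pi.add_apply, h2, h3, h4, Pi.add_apply, mul_add]
      map_smul' := fun a g => by
        refine Lp.ext ?_
        filter_upwards [(memLp_weight_mul (a • g)).coeFn_toLp, (memLp_weight_mul g).coeFn_toLp,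
          Lp.coeFn_smul a g, Lp.coeFn_smul a ((memLp_weight_mul g).toLp _)] with x h1 h2 h3 h4
        rw [h1, RingHom.id_apply, h4, Pi.smul_apply, h2, h3, Pi.smul_apply, smul_eq_mul,
          smul_eq_mul]
        ring }
    1 fun g => by
      rw [one_mul]
      refine Lp.norm_le_norm_of_ae_le ?_
      filter_upwards [(memLp_weight_mul g).coeFn_toLp] with x h
      change ‖((memLp_weight_mul g).toLp _ : L2 d) x‖ ≤ _
      rw [h, norm_mul, Complex.norm_real, Real.norm_of_nonneg (weight_nonneg x)]
      exact mul_le_of_le_one_left (norm_nonneg _) (weight_le_one x)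

lemma weightMul_coeFn (g : L2 d) :
    (weightMul d g : E d → ℂ) =ᵐ[volume] fun x => (weight d x : ℂ) * g x :=
  (memLp_weight_mul g).coeFn_toLp

lemma inner_weightMul (g h : L2 d) :
    inner ℂ (weightMul d h) g = ∫ x, g x * conj (h x) * (weight d x : ℂ) := by
  rw [L2.inner_def]
  refine integral_congr_ae ?_
  filter_upwards [weightMul_coeFn h] with x hx
  rw [hx, RCLike.inner_apply, map_mul, Complex.conj_ofReal]
  ring

lemma inner_weightMul_self (g : L2 d) :
    inner ℂ (weightMul d g) g = ((∫ x, ‖g x‖ ^ 2 * weight d x : ℝ) : ℂ) := by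
  rw [inner_weightMul, ← integral_complex_ofReal]
  refine integral_congr_ae (Eventually.of_forall fun x => ?_)
  simp only [Complex.mul_conj, Complex.normSq_eq_norm_sq]
  push_cast
  rfl

lemma eq_zero_of_integral_norm_sq_mul_weight (hΩ : IsCompact Ω) {g : L2 d} (hg : g ∈ PW Ω)
    (h : ∫ x, ‖g x‖ ^ 2 * weight d x = 0) : g = 0 := by
  obtain ⟨a, ha, hle⟩ := exists_le_integral_norm_sq_mul_weight hΩ
  have := hle g hg
  rw [h] at this
  have h2 : ‖g‖ ^ 2 ≤ 0 := by
    by_contra hc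
    rw [not_le] at hc
    nlinarith
  exact norm_eq_zero.mp (by nlinarith [norm_nonneg g])

/-- Riesz representation of the point evaluations with respect to the weighted inner product. -/
lemma exists_kernelVec (hΩ : IsCompact Ω) (w : Fin d → ℂ) : ∃ k ∈ PW Ω, ∀ g ∈ PW Ω,
    ext g w = inner ℂ (weightMul d k) g := by
  have hmem := mem_pwSubmodule hΩ.measurableSet
  have : CompleteSpace (pwSubmodule Ω) := (isClosed_pwSubmodule Ω).completeSpace_coe
  -- the compression of the multiplication operator to `PW Ω` is coercive, hence invertible
  let B : pwSubmodule Ω →L[ℂ] pwSubmodule Ω :=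
    (pwSubmodule Ω).orthogonalProjectionOnto ∘L weightMul d ∘L (pwSubmodule Ω).subtypeL
  have hB : ∀ k g : pwSubmodule Ω, inner ℂ (B k) g = inner ℂ (weightMul d k) (g : L2 d) := by
    intro k g
    exact Submodule.inner_orthogonalProjectionOnto_eq_of_mem_right g _
  obtain ⟨a, ha, hle⟩ := exists_le_integral_norm_sq_mul_weight hΩ
  have hunit : IsUnit B := by
    refine B.isUnit_of_forall_le_norm_inner_map (c := ⟨a, ha.le⟩) ha fun g => ?_
    have h1 := hle g ((hmem _).mp g.2)
    rw [hB, inner_weightMul_self, Complex.norm_real]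
    calc ‖g‖ ^ 2 * a = a * ‖(g : L2 d)‖ ^ 2 := by rw [mul_comm]; rfl
      _ ≤ _ := h1.trans (le_abs_self _)
  obtain ⟨k, hk⟩ := (ContinuousLinearMap.isUnit_iff_bijective.mp hunit).2
    ((pwSubmodule Ω).orthogonalProjectionOnto (evalVec hΩ w))
  refine ⟨k, (hmem _).mp k.2, fun g hg => ?_⟩
  have hg' := (hmem g).mpr hg
  rw [ext_eq_inner_evalVec hΩ hg, ← hB k ⟨g, hg'⟩, hk]
  exact (Submodule.inner_orthogonalProjectionOnto_eq_of_mem_right (⟨g, hg'⟩ : pwSubmodule Ω) _).symm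

lemma integral_ext_eq_inner (hΩ : IsCompact Ω) {k : L2 d} (hk : k ∈ PW Ω) (g : L2 d) :
    ∫ v, g v * conj (ext k (toC v)) * (weight d v : ℂ) = inner ℂ (weightMul d k) g := by
  rw [inner_weightMul]
  refine integral_congr_ae ?_
  filter_upwards [ext_toC_ae_eq hΩ hk] with x hx
  rw [hx]

lemma existsUnique_reproducingKernel (hΩ : IsCompact Ω) :
    ∃! K : (Fin d → ℂ) → (Fin d → ℂ) → ℂ, IsReproducingKernel Ω K := by
  choose k hk hrep using exists_kernelVec hΩ
  refine ⟨fun w z => ext (k w) z, ⟨fun w => ⟨k w, hk w, fun z => rfl⟩, fun g hg w => ?_⟩, ?_⟩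
  · rw [integral_ext_eq_inner hΩ (hk w)]
    exact hrep w g hg
  · intro K hK
    funext w z
    obtain ⟨k', hk', hKw⟩ := hK.1 w
    suffices h : k' = k w by rw [hKw, h]
    have hsub : k' - k w ∈ PW Ω := by
      rw [← mem_pwSubmodule hΩ.measurableSet] at hk' ⊢
      exact Submodule.sub_mem _ hk' ((mem_pwSubmodule hΩ.measurableSet _).mpr (hk w))
    have h1 := hK.2 _ hsub w
    simp only [hKw] at h1
    rw [integral_ext_eq_inner hΩ hk', hrep w _ hsub] at h1
    have h2 : inner ℂ (weightMul d (k' - k w)) (k' - k w) = 0 := by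
      rw [map_sub, inner_sub_left, h1, sub_self]
    rw [inner_weightMul_self, Complex.ofReal_eq_zero] at h2
    exact sub_eq_zero.mp (eq_zero_of_integral_norm_sq_mul_weight hΩ hsub h2)

/-- The value at the origin of a reproducing kernel, in terms of the vector representing the
evaluation at the origin. -/
lemma IsReproducingKernel.exists_vec (hΩ : IsCompact Ω) {K : (Fin d → ℂ) → (Fin d → ℂ) → ℂ}
    (hK : IsReproducingKernel Ω K) : ∃ k ∈ PW Ω, ext k 0 = K 0 0 ∧
      K 0 0 = ((∫ x, ‖k x‖ ^ 2 * weight d x : ℝ) : ℂ) ∧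
      ∀ g ∈ PW Ω, ext g 0 = inner ℂ (weightMul d k) g := by
  obtain ⟨k, hk, hKk⟩ := hK.1 0
  have hrep : ∀ g ∈ PW Ω, ext g 0 = inner ℂ (weightMul d k) g := by
    intro g hg
    rw [hK.2 g hg 0, ← integral_ext_eq_inner hΩ hk]
    simp only [hKk]
  refine ⟨k, hk, (hKk 0).symm, ?_, hrep⟩
  rw [hKk, hrep k hk, inner_weightMul_self]

lemma toC_zero : toC (0 : E d) = 0 := by
  funext i; simp [toC]

end Kernel

/-! ### Density of smooth band-limited functions -/

section Density

variable {d : ℕ} {Ω : Set (E d)}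

/-- The test functions with compact support in the interior of `Ω`. -/
noncomputable def testSubmodule (Ω : Set (E d)) : Submodule ℂ 𝓢(E d, ℂ) where
  carrier := {φ | HasCompactSupport φ ∧ tsupport φ ⊆ interior Ω}
  zero_mem' := by
    have h : tsupport ((0 : 𝓢(E d, ℂ)) : E d → ℂ) = ∅ := tsupport_eq_empty_iff.mpr rfl
    exact ⟨by rw [HasCompactSupport, h]; exact isCompact_empty, by rw [h]; exact Set.empty_subset _⟩
  add_mem' := fun {φ ψ} hφ hψ =>
    ⟨hφ.1.add hψ.1, (tsupport_add _ _).trans (Set.union_subset hφ.2 hψ.2)⟩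
  smul_mem' := fun a φ hφ => by
    have h : tsupport (a • φ : 𝓢(E d, ℂ)) ⊆ tsupport φ :=
      closure_mono fun x hx hx0 => hx (by simp [hx0])
    exact ⟨hφ.1.mono' (subset_tsupport _ |>.trans h), h.trans hφ.2⟩

/-- The functions whose Fourier transforms are the test functions in the interior of `Ω`. -/
noncomputable def smoothPW (Ω : Set (E d)) : Submodule ℂ (L2 d) :=
  (testSubmodule Ω).map ((SchwartzMap.toLpCLM ℂ ℂ 2 volume).toLinearMap ∘ₗ
    (FourierTransform.fourierInvCLM ℂ 𝓢(E d, ℂ)).toLinearMap)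

lemma mem_smoothPW {g : L2 d} :
    g ∈ smoothPW Ω ↔ ∃ φ ∈ testSubmodule Ω, (𝓕⁻ φ : 𝓢(E d, ℂ)).toLp 2 = g := Iff.rfl

lemma smoothPW_le (hΩ : IsCompact Ω) : smoothPW Ω ≤ pwSubmodule Ω := by
  intro g hg
  obtain ⟨φ, hφ, rfl⟩ := mem_smoothPW.mp hg
  exact (mem_pwSubmodule hΩ.measurableSet _).mpr
    (toLp_fourierInv_mem_PW (hφ.2.trans interior_subset))

/-- An element of `PW Ω` orthogonal to all smooth elements vanishes, because the boundary of a
convex set is a null set. -/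
lemma eq_zero_of_mem_orthogonal (hc : Convex ℝ Ω) {u : L2 d} (hu : u ∈ PW Ω)
    (h : u ∈ (smoothPW Ω)ᗮ) : u = 0 := by
  have hint : ∀ᵐ ξ : E d, ξ ∈ interior Ω → (𝓕 u : L2 d) ξ = 0 := by
    refine isOpen_interior.ae_eq_zero_of_integral_contDiff_smul_eq_zero
      (((Lp.memLp _).locallyIntegrable (by norm_num)).locallyIntegrableOn _)
      fun g hg hgc hgs => ?_
    have hg₁ : HasCompactSupport (Complex.ofRealCLM ∘ g) := hgc.comp_left rfl
    have hg₂ : ContDiff ℝ ∞ (Complex.ofRealCLM ∘ g) := by fun_prop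
    set ψ : 𝓢(E d, ℂ) := hg₁.toSchwartzMap hg₂
    have hψx : ∀ x, ψ x = (g x : ℂ) := fun x => rfl
    have hψs : tsupport ψ ⊆ tsupport g := closure_mono fun x hx hx0 => hx (by simp [hψx, hx0])
    have h1 : inner ℂ ((𝓕⁻ ψ : 𝓢(E d, ℂ)).toLp 2 : L2 d) u = 0 :=
      h _ (mem_smoothPW.mpr ⟨ψ, ⟨hg₁, hψs.trans hgs⟩, rfl⟩)
    rw [← Lp.inner_fourier_eq, SchwartzMap.toLp_fourier_eq,
      FourierTransform.fourier_fourierInv_eq, L2.inner_def] at h1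
    rw [← h1]
    refine integral_congr_ae ?_
    filter_upwards [ψ.coeFn_toLp 2 volume] with ξ hξ
    rw [hξ, RCLike.inner_apply, hψx, Complex.conj_ofReal, Complex.real_smul, mul_comm]
  have hfr : ∀ᵐ ξ : E d, ξ ∉ frontier Ω :=
    measure_eq_zero_iff_ae_notMem.mp (hc.addHaar_frontier volume)
  have h0 : (𝓕 u : L2 d) = 0 := by
    rw [Lp.eq_zero_iff_ae_eq_zero]
    filter_upwards [hint, hfr, hu] with ξ h1 h2 h3
    by_cases hξ : ξ ∈ Ω
    · refine h1 ?_
      by_contra hni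
      exact h2 ⟨subset_closure hξ, hni⟩
    · exact h3 hξ
  rw [← norm_eq_zero, ← Lp.norm_fourier_eq u, h0, norm_zero]

lemma mem_closure_smoothPW (hΩ : IsCompact Ω) (hc : Convex ℝ Ω) {g : L2 d} (hg : g ∈ PW Ω) :
    g ∈ closure (smoothPW Ω : Set (L2 d)) := by
  set T := (smoothPW Ω).topologicalClosure with hT
  have hTcl : IsClosed (T : Set (L2 d)) := (smoothPW Ω).isClosed_topologicalClosure
  have : CompleteSpace T := hTcl.completeSpace_coe
  have hle : T ≤ pwSubmodule Ω :=
    Submodule.topologicalClosure_minimal _ (smoothPW_le hΩ) (isClosed_pwSubmodule Ω)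
  have hu1 : g - T.starProjection g ∈ Tᗮ := Submodule.sub_starProjection_mem_orthogonal g
  have hu2 : g - T.starProjection g ∈ pwSubmodule Ω :=
    Submodule.sub_mem _ ((mem_pwSubmodule hΩ.measurableSet g).mpr hg)
      (hle (Submodule.starProjection_apply_mem T g))
  have h0 := eq_zero_of_mem_orthogonal hc ((mem_pwSubmodule hΩ.measurableSet _).mp hu2)
    (Submodule.orthogonal_le (smoothPW Ω).le_topologicalClosure hu1)
  rw [← Submodule.topologicalClosure_coe, ← hT, sub_eq_zero.mp h0]
  exact Submodule.starProjection_apply_mem T g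

/-- A quadratic lower bound for the weighted norm in terms of the value at the origin extends from
smooth band-limited functions to all of `PW Ω`. -/
lemma mul_norm_ext_sq_le (hΩ : IsCompact Ω) (hc : Convex ℝ Ω) {c : ℝ}
    (h : ∀ φ ∈ testSubmodule Ω, c * ‖(𝓕⁻ φ : 𝓢(E d, ℂ)) 0‖ ^ 2 ≤
      ∫ x, ‖(𝓕⁻ φ : 𝓢(E d, ℂ)) x‖ ^ 2 * weight d x) {g : L2 d} (hg : g ∈ PW Ω) :
    c * ‖ext g 0‖ ^ 2 ≤ ∫ x, ‖g x‖ ^ 2 * weight d x := by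
  have hre : ∀ g : L2 d, ∫ x, ‖g x‖ ^ 2 * weight d x = (inner ℂ (weightMul d g) g : ℂ).re := by
    intro g
    rw [inner_weightMul_self, Complex.ofReal_re]
  have hclosed : IsClosed {g : L2 d | c * ‖inner ℂ (evalVec hΩ 0) g‖ ^ 2 ≤
      (inner ℂ (weightMul d g) g : ℂ).re} := by
    refine isClosed_le (by fun_prop) ?_
    exact Complex.continuous_re.comp ((weightMul d).continuous.inner continuous_id)
  have hsub : (smoothPW Ω : Set (L2 d)) ⊆ {g : L2 d | c * ‖inner ℂ (evalVec hΩ 0) g‖ ^ 2 ≤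
      (inner ℂ (weightMul d g) g : ℂ).re} := by
    intro g hg
    obtain ⟨φ, hφ, rfl⟩ := mem_smoothPW.mp hg
    have hmem := toLp_fourierInv_mem_PW (hφ.2.trans interior_subset)
    rw [Set.mem_ofPred_eq, ← ext_eq_inner_evalVec hΩ hmem, ← toC_zero, ext_toLp_fourierInv, ← hre]
    refine (h φ hφ).trans (le_of_eq (integral_congr_ae ?_))
    filter_upwards [(𝓕⁻ φ : 𝓢(E d, ℂ)).coeFn_toLp 2 volume] with x hx
    rw [hx]
  have := hclosed.closure_subset_iff.mpr hsub (mem_closure_smoothPW hΩ hc hg)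
  rwa [Set.mem_ofPred_eq, ← ext_eq_inner_evalVec hΩ hg, ← hre] at this

/-- There is a test function in the interior of `Ω` whose inverse Fourier transform does not vanish
at the origin. -/
lemma exists_testSubmodule_ne_zero (hne : (interior Ω).Nonempty) :
    ∃ φ ∈ testSubmodule Ω, (𝓕⁻ φ : 𝓢(E d, ℂ)) 0 ≠ 0 := by
  obtain ⟨ξ₀, hξ₀⟩ := hne
  obtain ⟨f, hfs, hfc, hf, hfr, hf1⟩ :=
    exists_contDiff_tsupport_subset (n := ⊤) (isOpen_interior.mem_nhds hξ₀)
  have hg₁ : HasCompactSupport (Complex.ofRealCLM ∘ f) := hfc.comp_left rfl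
  have hg₂ : ContDiff ℝ ∞ (Complex.ofRealCLM ∘ f) := Complex.ofRealCLM.contDiff.comp hf
  set ψ : 𝓢(E d, ℂ) := hg₁.toSchwartzMap hg₂
  have hψx : ∀ x, ψ x = (f x : ℂ) := fun x => rfl
  have hψs : tsupport ψ ⊆ tsupport f := closure_mono fun x hx hx0 => hx (by simp [hψx, hx0])
  refine ⟨ψ, ⟨hg₁, hψs.trans hfs⟩, ?_⟩
  have h1 : (𝓕⁻ ψ : 𝓢(E d, ℂ)) 0 = ((∫ x, f x : ℝ) : ℂ) := by
    rw [SchwartzMap.fourierInv_coe, Real.fourierInv_eq, ← integral_complex_ofReal]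
    simp [hψx]
  rw [h1, Complex.ofReal_ne_zero]
  refine (hf.continuous.integral_pos_of_hasCompactSupport_nonneg_nonzero hfc
    (fun x => (hfr ⟨x, rfl⟩).1) (x := ξ₀) ?_).ne'
  rw [hf1]; exact one_ne_zero

/-- A reproducing kernel is real and positive at the origin. -/
lemma IsReproducingKernel.pos (hΩ : IsCompact Ω) (hne : (interior Ω).Nonempty)
    {K : (Fin d → ℂ) → (Fin d → ℂ) → ℂ} (hK : IsReproducingKernel Ω K) :
    (K 0 0).im = 0 ∧ 0 < (K 0 0).re := by
  obtain ⟨k, hk, -, hK0, hrep⟩ := hK.exists_vec hΩ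
  refine ⟨by rw [hK0, Complex.ofReal_im], ?_⟩
  rw [hK0, Complex.ofReal_re]
  refine lt_of_le_of_ne (integral_nonneg fun x => mul_nonneg (by positivity) (weight_nonneg x))
    fun h0 => ?_
  have hk0 := eq_zero_of_integral_norm_sq_mul_weight hΩ hk h0.symm
  obtain ⟨φ, hφ, hφ0⟩ := exists_testSubmodule_ne_zero hne
  have := hrep _ (toLp_fourierInv_mem_PW (hφ.2.trans interior_subset))
  rw [hk0, map_zero, inner_zero_left, ← toC_zero, ext_toLp_fourierInv] at this
  exact hφ0 this

/-! ### The body -/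

/-- The norm `x ↦ |x₁| + ⋯ + |x_d| + |x₁ + ⋯ + x_d|` with unit ball `H_d`. -/
noncomputable def bodyNorm (x : E d) : ℝ := ∑ i, |x i| + |∑ i, x i|

lemma continuous_bodyNorm : Continuous (bodyNorm (d := d)) := by
  unfold bodyNorm; fun_prop

lemma bodyNorm_smul (a : ℝ) (x : E d) : bodyNorm (a • x) = |a| * bodyNorm x := by
  simp only [bodyNorm, PiLp.smul_apply, smul_eq_mul, abs_mul, ← Finset.mul_sum]
  ring

lemma bodyNorm_add_le (x y : E d) : bodyNorm (x + y) ≤ bodyNorm x + bodyNorm y := by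
  have h1 : ∑ i, |x i + y i| ≤ ∑ i, |x i| + ∑ i, |y i| := by
    rw [← Finset.sum_add_distrib]
    exact Finset.sum_le_sum fun i _ => abs_add_le _ _
  have h2 := abs_add_le (∑ i, x i) (∑ i, y i)
  simp only [bodyNorm, PiLp.add_apply, Finset.sum_add_distrib]
  linarith

lemma bodyNorm_sub_le (x y : E d) : bodyNorm (x - y) ≤ bodyNorm x + bodyNorm y := by
  have h := bodyNorm_add_le x ((-1 : ℝ) • y)
  rw [bodyNorm_smul] at h
  simpa [sub_eq_add_neg] using h

lemma smul_bodyH_eq {a : ℝ} (ha : 0 < a) : a • bodyH d = {x | bodyNorm x ≤ a} := by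
  ext x
  rw [Set.mem_smul_set_iff_inv_smul_mem₀ ha.ne']
  change bodyNorm (a⁻¹ • x) ≤ 1 ↔ bodyNorm x ≤ a
  rw [bodyNorm_smul, abs_of_pos (by positivity), inv_mul_le_iff₀ ha, mul_one]

lemma norm_le_bodyNorm (x : E d) : ‖x‖ ≤ bodyNorm x := by
  have h1 : ‖x‖ ^ 2 ≤ (∑ i, |x i|) ^ 2 := by
    rw [EuclideanSpace.norm_sq_eq]
    simpa using Finset.sum_sq_le_sq_sum_of_nonneg (s := Finset.univ) (f := fun i => |x i|)
      fun i _ => abs_nonneg (x i)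
  have h2 : ‖x‖ ≤ ∑ i, |x i| := le_of_sq_le_sq h1 (by positivity)
  exact h2.trans (le_add_of_nonneg_right (abs_nonneg _))

lemma isCompact_smul_bodyH {a : ℝ} (ha : 0 < a) : IsCompact (a • bodyH d) := by
  rw [smul_bodyH_eq ha]
  refine Metric.isCompact_of_isClosed_isBounded
    (isClosed_le continuous_bodyNorm continuous_const) ?_
  refine (Metric.isBounded_closedBall (x := (0 : E d)) (r := a)).subset fun x hx => ?_
  rw [mem_closedBall_zero_iff]
  exact (norm_le_bodyNorm x).trans hx

lemma convex_smul_bodyH {a : ℝ} (ha : 0 < a) : Convex ℝ (a • bodyH d) := by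
  rw [smul_bodyH_eq ha]
  intro x hx y hy s t hs ht hst
  refine (bodyNorm_add_le _ _).trans ?_
  rw [bodyNorm_smul, bodyNorm_smul, abs_of_nonneg hs, abs_of_nonneg ht]
  calc s * bodyNorm x + t * bodyNorm y ≤ s * a + t * a := by gcongr <;> assumption
    _ = a := by rw [← add_mul, hst, one_mul]

lemma bodyNorm_lt_of_mem_interior {a : ℝ} (ha : 0 < a) {x : E d}
    (hx : x ∈ interior (a • bodyH d)) : bodyNorm x < a := by
  rw [smul_bodyH_eq ha] at hx
  have hcont : ContinuousAt (fun t : ℝ => t • x) 1 := by fun_prop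
  have hev : ∀ᶠ t in 𝓝 (1 : ℝ), t • x ∈ {x | bodyNorm x ≤ a} := by
    refine hcont.eventually_mem ?_
    rw [one_smul]
    exact mem_interior_iff_mem_nhds.mp hx
  obtain ⟨t, ht, ht1⟩ := (hev.filter_mono nhdsWithin_le_nhds).and
    (self_mem_nhdsWithin (a := (1 : ℝ)) (s := Set.Ioi 1)) |>.exists
  rw [Set.mem_ofPred_eq, bodyNorm_smul, abs_of_pos (zero_lt_one.trans ht1)] at ht
  have ht1' : 1 < t := ht1
  by_contra hcon
  rw [not_lt] at hcon
  nlinarith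

lemma interior_smul_bodyH_nonempty {a : ℝ} (ha : 0 < a) : (interior (a • bodyH d)).Nonempty := by
  refine ⟨0, ?_⟩
  rw [smul_bodyH_eq ha]
  have hsub : {x : E d | bodyNorm x < a} ⊆ {x | bodyNorm x ≤ a} := fun x (hx : bodyNorm x < a) =>
    hx.le
  refine mem_interior.mpr ⟨_, hsub, isOpen_lt continuous_bodyNorm continuous_const, ?_⟩
  simpa [bodyNorm] using ha

end Density

/-! ### Coordinates on the hyperplane of zero sum -/

section Coordinates

variable {d : ℕ}

/-- The coordinates `x ↦ (x₁ - x_n, …, x_d - x_n)` of `ℝ^n` modulo the diagonal,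
where `n = d + 1`. -/
noncomputable def diffMap (d : ℕ) : E (d + 1) →ₗ[ℝ] E d where
  toFun x := WithLp.toLp 2 fun i => x i.castSucc - x (Fin.last d)
  map_add' x y := by ext i; simp; ring
  map_smul' a x := by ext i; simp; ring

@[simp] lemma diffMap_apply (x : E (d + 1)) (i : Fin d) :
    diffMap d x i = x i.castSucc - x (Fin.last d) := rfl

/-- The parametrization `y ↦ (y, -(y₁ + ⋯ + y_d))` of the hyperplane of zero sum. -/
noncomputable def zeroSum (d : ℕ) : E d →ₗ[ℝ] E (d + 1) where
  toFun y := WithLp.toLp 2 (Fin.snoc (α := fun _ => ℝ) y (-∑ i, y i))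
  map_add' x y := by
    ext i
    refine Fin.lastCases ?_ (fun j => ?_) i
    · simp [Finset.sum_add_distrib]; ring
    · simp
  map_smul' a x := by
    ext i
    refine Fin.lastCases ?_ (fun j => ?_) i <;> simp [Finset.mul_sum]

@[simp] lemma zeroSum_castSucc (y : E d) (i : Fin d) : zeroSum d y i.castSucc = y i := by
  simp [zeroSum]

@[simp] lemma zeroSum_last (y : E d) : zeroSum d y (Fin.last d) = -∑ i, y i := by
  simp [zeroSum]

lemma sum_zeroSum (y : E d) : ∑ i, zeroSum d y i = 0 := by
  simp [Fin.sum_univ_castSucc]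

lemma deltaIntegral_eq (F : E (d + 1) → ℝ) :
    deltaIntegral d F = ((d : ℝ) + 1) * ∫ y, F (zeroSum d y) := rfl

/-- The projection of `(v, 0)` to the hyperplane of zero sum along the diagonal. -/
noncomputable def centered (d : ℕ) : E d →ₗ[ℝ] E (d + 1) where
  toFun v := WithLp.toLp 2 fun i => snocZero d v i - (∑ j, v j) / ((d : ℝ) + 1)
  map_add' x y := by ext i; simp [Finset.sum_add_distrib]; ring
  map_smul' a x := by ext i; simp [← Finset.mul_sum]; ring

lemma centered_apply (v : E d) (i : Fin (d + 1)) :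
    centered d v i = snocZero d v i - (∑ j, v j) / ((d : ℝ) + 1) := rfl

lemma sum_centered (v : E d) : ∑ i, centered d v i = 0 := by
  have : ((d : ℝ) + 1) ≠ 0 := by positivity
  simp only [centered_apply, Finset.sum_sub_distrib, Finset.sum_const, Finset.card_univ,
    Fintype.card_fin, nsmul_eq_mul, Fin.sum_univ_castSucc, snocZero_castSucc, snocZero_last]
  push_cast
  field_simp
  ring

lemma diffMap_centered (v : E d) : diffMap d (centered d v) = v := by
  ext i; simp [centered_apply]

lemma centered_diffMap {x : E (d + 1)} (hx : ∑ i, x i = 0) : centered d (diffMap d x) = x := by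
  have : ((d : ℝ) + 1) ≠ 0 := by positivity
  have hsum : (∑ j, diffMap d x j) / ((d : ℝ) + 1) = -x (Fin.last d) := by
    rw [Fin.sum_univ_castSucc] at hx
    simp only [diffMap_apply, Finset.sum_sub_distrib, Finset.sum_const, Finset.card_univ,
      Fintype.card_fin, nsmul_eq_mul]
    rw [div_eq_iff this]
    linarith
  ext i
  rw [centered_apply, hsum]
  refine Fin.lastCases ?_ (fun j => ?_) i <;> simp

/-- Permutation of the coordinates. -/
noncomputable def permMap {n : ℕ} (σ : Equiv.Perm (Fin n)) : E n →ₗ[ℝ] E n where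
  toFun x := WithLp.toLp 2 fun i => x (σ i)
  map_add' x y := by ext i; simp
  map_smul' a x := by ext i; simp

@[simp] lemma permMap_apply {n : ℕ} (σ : Equiv.Perm (Fin n)) (x : E n) (i : Fin n) :
    permMap σ x i = x (σ i) := rfl

lemma permMap_mul {n : ℕ} (σ τ : Equiv.Perm (Fin n)) (x : E n) :
    permMap (τ * σ) x = permMap σ (permMap τ x) := rfl

lemma sum_permMap {n : ℕ} (σ : Equiv.Perm (Fin n)) (x : E n) : ∑ i, permMap σ x i = ∑ i, x i :=
  Equiv.sum_comp σ fun i => x i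

lemma norm_permMap {n : ℕ} (σ : Equiv.Perm (Fin n)) (x : E n) : ‖permMap σ x‖ = ‖x‖ := by
  rw [EuclideanSpace.norm_eq, EuclideanSpace.norm_eq]
  congr 1
  exact Equiv.sum_comp σ fun i => ‖x i‖ ^ 2

lemma weight_diffMap (x : E (d + 1)) : weight d (diffMap d x) = dysonW (d + 1) x := by
  rw [weight_eq]
  have key : ∀ i, snocZero d (diffMap d x) i = x i - x (Fin.last d) := by
    intro i
    refine Fin.lastCases ?_ (fun j => ?_) i <;> simp
  refine dysonW_congr fun i j => ?_
  rw [key, key]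
  ring

lemma map_linearMap_volume {A : E d →ₗ[ℝ] E d} (hA : LinearMap.det A ≠ 0) :
    Measure.map A (volume : Measure (E d)) = ENNReal.ofReal |(LinearMap.det A)⁻¹| • volume :=
  Measure.map_linearMap_addHaar_eq_smul_addHaar volume hA

lemma measurableEmbedding_of_det_ne_zero {A : E d →ₗ[ℝ] E d} (hA : LinearMap.det A ≠ 0) :
    MeasurableEmbedding A := by
  let e : E d ≃ₗ[ℝ] E d := LinearMap.equivOfDetNeZero A hA
  exact e.toContinuousLinearEquiv.toHomeomorph.measurableEmbedding

lemma integral_comp_linearMap {A : E d →ₗ[ℝ] E d} (hA : LinearMap.det A ≠ 0) (F : E d → ℝ) :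
    |LinearMap.det A| * ∫ y, F (A y) = ∫ y, F y := by
  rw [← (measurableEmbedding_of_det_ne_zero hA).integral_map, map_linearMap_volume hA,
    integral_smul_measure, ENNReal.toReal_ofReal (abs_nonneg _), smul_eq_mul, ← mul_assoc, abs_inv,
    mul_inv_cancel₀ (abs_ne_zero.mpr hA), one_mul]

lemma integrable_comp_linearMap {A : E d →ₗ[ℝ] E d} (hA : LinearMap.det A ≠ 0) {F : E d → ℝ}
    (hF : Integrable F) : Integrable fun y => F (A y) := by
  refine ((measurableEmbedding_of_det_ne_zero hA).integrable_map_iff (g := F)).mp ?_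
  rw [map_linearMap_volume hA]
  exact hF.smul_measure ENNReal.ofReal_ne_top

/-- The Jacobian of `y ↦ (yᵢ + y₁ + ⋯ + y_d)ᵢ` is `d + 1`. -/
lemma det_diffMap_zeroSum : LinearMap.det (diffMap d ∘ₗ zeroSum d) = (d : ℝ) + 1 := by
  let s : Module.Dual ℝ (E d) :=
    { toFun := fun y => ∑ i, y i
      map_add' := fun x y => by simp [Finset.sum_add_distrib]
      map_smul' := fun a x => by simp [Finset.mul_sum] }
  have h : diffMap d ∘ₗ zeroSum d = LinearMap.transvection s (WithLp.toLp 2 fun _ => 1) := by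
    ext y i
    simp [LinearMap.transvection.apply, s]
  rw [h, LinearMap.transvection.det]
  simp [s, add_comm]

/-- The action of a permutation on the hyperplane of zero sum, in the coordinates of `zeroSum`. -/
noncomputable def permZeroSum (σ : Equiv.Perm (Fin (d + 1))) : E d →ₗ[ℝ] E d where
  toFun y := WithLp.toLp 2 fun i => permMap σ (zeroSum d y) i.castSucc
  map_add' x y := by ext i; simp
  map_smul' a x := by ext i; simp

lemma zeroSum_permZeroSum (σ : Equiv.Perm (Fin (d + 1))) (y : E d) :
    zeroSum d (permZeroSum σ y) = permMap σ (zeroSum d y) := by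
  ext i
  refine Fin.lastCases ?_ (fun j => ?_) i
  · have h := sum_permMap σ (zeroSum d y)
    rw [sum_zeroSum, Fin.sum_univ_castSucc] at h
    rw [zeroSum_last]
    have h2 : ∀ i, permZeroSum σ y i = permMap σ (zeroSum d y) i.castSucc := fun i => rfl
    simp only [h2]
    linarith
  · rw [zeroSum_castSucc]; rfl

lemma zeroSum_injective : Function.Injective (zeroSum d) := by
  intro x y h
  ext i
  rw [← zeroSum_castSucc, h, zeroSum_castSucc]

/-- Permutations preserve the volume of the hyperplane: they have finite order. -/
lemma abs_det_permZeroSum (σ : Equiv.Perm (Fin (d + 1))) : |LinearMap.det (permZeroSum σ)| = 1 := by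
  have hpow : ∀ (k : ℕ) (y : E d),
      zeroSum d ((permZeroSum σ ^ k) y) = permMap (σ ^ k) (zeroSum d y) := by
    intro k
    induction k with
    | zero => intro y; ext i; simp
    | succ k ih =>
      intro y
      rw [pow_succ', Module.End.mul_apply, zeroSum_permZeroSum, ih, ← permMap_mul, ← pow_succ]
  have h1 : permZeroSum σ ^ orderOf σ = 1 := by
    ext1 y
    apply zeroSum_injective
    rw [hpow, pow_orderOf_eq_one]
    ext i; simp
  have h2 : |LinearMap.det (permZeroSum σ)| ^ orderOf σ = 1 := by
    rw [← abs_pow, ← map_pow, h1, map_one, abs_one]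
  exact (pow_eq_one_iff_of_nonneg (abs_nonneg _) (orderOf_pos σ).ne').mp h2

/-- The linear change of variables that computes `deltaIntegral` of a function of the permuted
coordinate differences. -/
lemma abs_det_diffMap_permMap_zeroSum (σ : Equiv.Perm (Fin (d + 1))) :
    |LinearMap.det (diffMap d ∘ₗ permMap σ ∘ₗ zeroSum d)| = (d : ℝ) + 1 := by
  have h : diffMap d ∘ₗ permMap σ ∘ₗ zeroSum d = (diffMap d ∘ₗ zeroSum d) ∘ₗ permZeroSum σ := by
    ext1 y
    simp only [LinearMap.comp_apply, zeroSum_permZeroSum]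
  rw [h, LinearMap.det_comp, abs_mul, abs_det_permZeroSum, mul_one, det_diffMap_zeroSum,
    abs_of_nonneg (by positivity)]

lemma det_diffMap_permMap_zeroSum_ne_zero (σ : Equiv.Perm (Fin (d + 1))) :
    LinearMap.det (diffMap d ∘ₗ permMap σ ∘ₗ zeroSum d) ≠ 0 := by
  rw [← abs_ne_zero, abs_det_diffMap_permMap_zeroSum]
  positivity

lemma deltaIntegral_comp (σ : Equiv.Perm (Fin (d + 1))) (F : E d → ℝ) :
    deltaIntegral d (fun x => F (diffMap d (permMap σ x))) = ∫ v, F v := by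
  rw [deltaIntegral_eq, ← integral_comp_linearMap (det_diffMap_permMap_zeroSum_ne_zero σ) F,
    abs_det_diffMap_permMap_zeroSum]
  rfl

lemma integral_mul_dysonW_eq (σ : Equiv.Perm (Fin (d + 1))) (G : E d → ℝ) :
    deltaIntegral d (fun x => G (diffMap d (permMap σ x)) * dysonW (d + 1) x) =
      ∫ v, G v * weight d v := by
  rw [← deltaIntegral_comp σ]
  congr 1
  funext x
  rw [weight_diffMap]
  congr 1
  exact (dysonW_perm σ x).symm

end Coordinates

/-! ### Admissible functions from band-limited functions -/

section Construction

variable {d : ℕ}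

/-- The Fourier pairing of `x ↦ |𝓕⁻ φ (A x)|²`, for a linear map `A` with transpose `S`, is a double
integral over the frequencies. -/
lemma integral_norm_sq_comp_mul_fourier {n : ℕ} (φ : 𝓢(E d, ℂ)) (ψ : 𝓢(E n, ℂ))
    (A : E n →ₗ[ℝ] E d) (S : E d →ₗ[ℝ] E n)
    (hAS : ∀ (η : E d) (x : E n), inner ℝ η (A x) = inner ℝ (S η) x) :
    ∫ x : E n, ((‖(𝓕⁻ φ : 𝓢(E d, ℂ)) (A x)‖ ^ 2 : ℝ) : ℂ) * (𝓕 ψ : 𝓢(E n, ℂ)) x =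
      ∫ p : E d × E d, φ p.1 * conj (φ p.2) * ψ (S (p.1 - p.2)) := by
  set e : E d → E n → ℂ := fun η x => (Real.fourierChar (inner ℝ η (A x)) : ℂ) with he
  have hAc : Continuous A := A.continuous_of_finiteDimensional
  have hecont : Continuous fun q : E n × (E d × E d) => e q.2.1 q.1 * conj (e q.2.2 q.1) := by
    simp only [he]
    have h1 : Continuous fun t : ℝ => (Real.fourierChar t : ℂ) :=
      continuous_subtype_val.comp Real.continuous_fourierChar
    refine (h1.comp ?_).mul (Complex.continuous_conj.comp (h1.comp ?_))
    · exact (continuous_fst.comp continuous_snd).inner (hAc.comp continuous_fst)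
    · exact (continuous_snd.comp continuous_snd).inner (hAc.comp continuous_fst)
  have hen : ∀ η x, ‖e η x‖ = 1 := fun η x => Circle.norm_coe _
  have hg : ∀ x, (𝓕⁻ φ : 𝓢(E d, ℂ)) (A x) = ∫ η, e η x * φ η := by
    intro x
    rw [SchwartzMap.fourierInv_coe, Real.fourierInv_eq]
    rfl
  have hsq : ∀ x, ((‖(𝓕⁻ φ : 𝓢(E d, ℂ)) (A x)‖ ^ 2 : ℝ) : ℂ) =
      ∫ p : E d × E d, (e p.1 x * φ p.1) * conj (e p.2 x * φ p.2) := by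
    intro x
    rw [Measure.volume_eq_prod, integral_prod_mul (μ := (volume : Measure (E d)))
      (ν := (volume : Measure (E d))) (fun η => e η x * φ η) (fun η => conj (e η x * φ η)),
      integral_conj, ← hg, Complex.mul_conj, Complex.normSq_eq_norm_sq]
  set Φ : E n → E d × E d → ℂ := fun x p =>
    (e p.1 x * φ p.1) * conj (e p.2 x * φ p.2) * (𝓕 ψ : 𝓢(E n, ℂ)) x with hΦ
  have hΦi : Integrable (Function.uncurry Φ) (volume.prod volume) := by
    have hp : Integrable (fun p : E d × E d => φ p.1 * conj (φ p.2)) (volume.prod volume) :=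
      φ.integrable.mul_prod (Complex.conjCLE.integrable_comp_iff.mpr φ.integrable)
    have h3 : Integrable (fun q : E n × (E d × E d) => (𝓕 ψ : 𝓢(E n, ℂ)) q.1 *
        (φ q.2.1 * conj (φ q.2.2))) (volume.prod volume) :=
      (𝓕 ψ : 𝓢(E n, ℂ)).integrable.mul_prod hp
    refine (h3.bdd_mul (c := 1) hecont.aestronglyMeasurable
      (Eventually.of_forall fun q => ?_)).congr (Eventually.of_forall fun q => ?_)
    · rw [norm_mul, RCLike.norm_conj, hen, hen, one_mul]
    · simp only [hΦ, Function.uncurry, map_mul]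
      ring
  calc _ = ∫ x, ∫ p, Φ x p := by
        refine integral_congr_ae (Eventually.of_forall fun x => ?_)
        simp only [hΦ]
        rw [hsq, integral_mul_const]
    _ = ∫ p, ∫ x, Φ x p := integral_integral_swap hΦi
    _ = _ := by
        refine integral_congr_ae (Eventually.of_forall fun p => ?_)
        have h1 : ∀ x, Φ x p = φ p.1 * conj (φ p.2) *
            (Real.fourierChar (inner ℝ x (S (p.1 - p.2))) • (𝓕 ψ : 𝓢(E n, ℂ)) x) := by
          intro x
          have h2 : e p.1 x * conj (e p.2 x) =
              (Real.fourierChar (inner ℝ x (S (p.1 - p.2))) : ℂ) := by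
            simp only [he]
            rw [← Circle.coe_inv_eq_conj, ← AddChar.map_neg_eq_inv, ← Circle.coe_mul,
              ← AddChar.map_add_eq_mul, hAS, hAS, ← sub_eq_add_neg, ← inner_sub_left, ← map_sub,
              real_inner_comm]
          rw [Circle.smul_def, smul_eq_mul, ← h2]
          simp only [hΦ, map_mul]
          ring
        simp only [h1]
        rw [integral_const_mul, ← Real.fourierInv_eq, ← SchwartzMap.fourierInv_coe,
          FourierTransform.fourierInv_fourier_eq]

/-- The symmetrization of `|𝓕⁻ φ|²`, as a translation invariant function on `ℝ^{d+1}`. -/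
noncomputable def symmetrized (φ : 𝓢(E d, ℂ)) (x : E (d + 1)) : ℝ :=
  ∑ σ : Equiv.Perm (Fin (d + 1)), ‖(𝓕⁻ φ : 𝓢(E d, ℂ)) (diffMap d (permMap σ x))‖ ^ 2

lemma contDiff_symmetrized (φ : 𝓢(E d, ℂ)) : ContDiff ℝ ∞ (symmetrized φ) := by
  refine ContDiff.sum fun σ _ => ContDiff.norm_sq ℝ ?_
  refine ((𝓕⁻ φ : 𝓢(E d, ℂ)).smooth ⊤).comp ?_
  exact (LinearMap.toContinuousLinearMap (diffMap d ∘ₗ permMap σ)).contDiff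

lemma symmetrized_perm (φ : 𝓢(E d, ℂ)) (τ : Equiv.Perm (Fin (d + 1))) (x : E (d + 1)) :
    symmetrized φ (permMap τ x) = symmetrized φ x := by
  unfold symmetrized
  simp only [← permMap_mul]
  exact Equiv.sum_comp (Equiv.mulLeft τ)
    fun σ => ‖(𝓕⁻ φ : 𝓢(E d, ℂ)) (diffMap d (permMap σ x))‖ ^ 2

lemma exists_norm_le_mul_norm_diffMap (d : ℕ) : ∃ C : ℝ, 0 ≤ C ∧ ∀ x : E (d + 1), ∑ i, x i = 0 →
    ‖x‖ ≤ C * ‖diffMap d x‖ := by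
  refine ⟨‖LinearMap.toContinuousLinearMap (centered d)‖, norm_nonneg _, fun x hx => ?_⟩
  conv_lhs => rw [← centered_diffMap hx]
  exact (LinearMap.toContinuousLinearMap (centered d)).le_opNorm _

lemma exists_decay_symmetrized (φ : 𝓢(E d, ℂ)) (k : ℕ) : ∃ C : ℝ, ∀ x : E (d + 1), ∑ i, x i = 0 →
    ‖x‖ ^ k * |symmetrized φ x| ≤ C := by
  obtain ⟨C, hC0, hC⟩ := exists_norm_le_mul_norm_diffMap d
  obtain ⟨M, hM0, hM⟩ := (𝓕⁻ φ : 𝓢(E d, ℂ)).decay k 0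
  obtain ⟨B, hB0, hB⟩ := (𝓕⁻ φ : 𝓢(E d, ℂ)).decay 0 0
  simp only [pow_zero, one_mul, norm_iteratedFDeriv_zero] at hM hB
  refine ⟨∑ _σ : Equiv.Perm (Fin (d + 1)), C ^ k * M * B, fun x hx => ?_⟩
  rw [abs_of_nonneg (Finset.sum_nonneg fun σ _ => by positivity), symmetrized, Finset.mul_sum]
  refine Finset.sum_le_sum fun σ _ => ?_
  have h1 := hC (permMap σ x) (by rw [sum_permMap, hx])
  rw [norm_permMap] at h1
  set v := diffMap d (permMap σ x)
  calc ‖x‖ ^ k * ‖(𝓕⁻ φ : 𝓢(E d, ℂ)) v‖ ^ 2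
      ≤ (C * ‖v‖) ^ k * ‖(𝓕⁻ φ : 𝓢(E d, ℂ)) v‖ ^ 2 := by gcongr
    _ = C ^ k * (‖v‖ ^ k * ‖(𝓕⁻ φ : 𝓢(E d, ℂ)) v‖) * ‖(𝓕⁻ φ : 𝓢(E d, ℂ)) v‖ := by ring
    _ ≤ C ^ k * M * B := by
        gcongr
        · exact hM v
        · exact hB v

lemma inner_diffMap_permMap (σ : Equiv.Perm (Fin (d + 1))) (η : E d) (x : E (d + 1)) :
    inner ℝ η (diffMap d (permMap σ x)) = inner ℝ (permMap σ⁻¹ (zeroSum d η)) x := by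
  have h1 : inner ℝ (permMap σ⁻¹ (zeroSum d η)) x =
      ∑ i, zeroSum d η i * x (σ i) := by
    rw [PiLp.inner_apply, ← Equiv.sum_comp σ]
    refine Finset.sum_congr rfl fun i _ => ?_
    simp [mul_comm]
  rw [h1, PiLp.inner_apply, Fin.sum_univ_castSucc]
  simp only [zeroSum_castSucc, zeroSum_last, diffMap_apply, permMap_apply, RCLike.inner_apply,
    conj_trivial, sub_mul, Finset.sum_sub_distrib, ← Finset.mul_sum]
  rw [sub_eq_add_neg, neg_mul, mul_comm (x (σ (Fin.last d)))]
  congr 1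
  exact Finset.sum_congr rfl fun i _ => mul_comm _ _

lemma sum_abs_permMap_zeroSum (σ : Equiv.Perm (Fin (d + 1))) (η : E d) :
    ∑ i, |permMap σ (zeroSum d η) i| = bodyNorm η := by
  simp only [permMap_apply]
  rw [Equiv.sum_comp σ fun i => |zeroSum d η i|, Fin.sum_univ_castSucc]
  simp [bodyNorm]

lemma integrable_norm_sq_schwartz {k : ℕ} (g : 𝓢(E k, ℂ)) : Integrable fun x => ‖g x‖ ^ 2 :=
  (memLp_two_iff_integrable_sq_norm g.continuous.aestronglyMeasurable).mp (g.memLp 2)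

lemma fourierSupport_symmetrized {a : ℝ} (ha : 0 < a) {φ : 𝓢(E d, ℂ)}
    (hφ : φ ∈ testSubmodule (a • bodyH d)) :
    fourierSupport (symmetrized φ) ⊆ {ξ | ∑ i, |ξ i| < 2 * a} := by
  intro ξ hξ
  by_contra hnot
  set S : Equiv.Perm (Fin (d + 1)) → E d →ₗ[ℝ] E (d + 1) := fun σ => permMap σ⁻¹ ∘ₗ zeroSum d
  set Q : Set (E (d + 1)) := ⋃ σ, S σ '' (tsupport φ - tsupport φ) with hQ
  have hKc : IsCompact (tsupport φ - tsupport φ) := by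
    rw [← Set.sub_image_prod]
    exact (hφ.1.isCompact.prod hφ.1.isCompact).image continuous_sub
  have hQc : IsCompact Q := isCompact_iUnion fun σ =>
    hKc.image (S σ).continuous_of_finiteDimensional
  have hQs : ∀ ξ ∈ Q, ∑ i, |ξ i| < 2 * a := by
    intro ξ hξ
    obtain ⟨σ, ⟨η, ⟨x, hx, y, hy, rfl⟩, rfl⟩⟩ := Set.mem_iUnion.mp hξ
    have h1 := bodyNorm_lt_of_mem_interior ha (hφ.2 hx)
    have h2 := bodyNorm_lt_of_mem_interior ha (hφ.2 hy)
    have h3 := bodyNorm_sub_le x y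
    have h4 : ∑ i, |S σ (x - y) i| = bodyNorm (x - y) := sum_abs_permMap_zeroSum σ⁻¹ (x - y)
    change ∑ i, |S σ (x - y) i| < 2 * a
    linarith
  rw [fourierSupport, Distribution.mem_dsupport_iff] at hξ
  refine hnot (hQs ξ (hξ Q (fun ψ hψ => ?_) hQc.isClosed))
  have hψ0 : ∀ z ∈ Q, ψ z = 0 := fun z hz =>
    image_eq_zero_of_notMem_tsupport fun h => hψ h hz
  have hint : ∀ σ ∈ Finset.univ, Integrable fun x : E (d + 1) =>
      ((‖(𝓕⁻ φ : 𝓢(E d, ℂ)) (diffMap d (permMap σ x))‖ ^ 2 : ℝ) : ℂ) *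
        (𝓕 ψ : 𝓢(E (d + 1), ℂ)) x := by
    intro σ _
    obtain ⟨B, hB0, hB⟩ := (𝓕⁻ φ : 𝓢(E d, ℂ)).decay 0 0
    simp only [pow_zero, one_mul, norm_iteratedFDeriv_zero] at hB
    refine (𝓕 ψ : 𝓢(E (d + 1), ℂ)).integrable.bdd_mul (c := B ^ 2) ?_
      (Eventually.of_forall fun x => ?_)
    · refine (Complex.continuous_ofReal.comp ?_).aestronglyMeasurable
      refine ((𝓕⁻ φ : 𝓢(E d, ℂ)).continuous.comp ?_).norm.pow 2
      exact (diffMap d ∘ₗ permMap σ).continuous_of_finiteDimensional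
    · rw [Complex.norm_real, Real.norm_of_nonneg (by positivity)]
      have := hB (diffMap d (permMap σ x))
      gcongr
  simp only [symmetrized, Complex.ofReal_sum, Finset.sum_mul]
  rw [integral_finsetSum _ hint]
  refine Finset.sum_eq_zero fun σ _ => ?_
  have h := integral_norm_sq_comp_mul_fourier φ ψ (diffMap d ∘ₗ permMap σ) (S σ)
    fun η x => inner_diffMap_permMap σ η x
  refine h.trans ?_
  refine (integral_congr_ae (Eventually.of_forall fun p => ?_)).trans (integral_zero _ _)
  by_cases h1 : p.1 ∈ tsupport φ
  · by_cases h2 : p.2 ∈ tsupport φ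
    · have : S σ (p.1 - p.2) ∈ Q :=
        Set.mem_iUnion.mpr ⟨σ, Set.mem_image_of_mem _ (Set.sub_mem_sub h1 h2)⟩
      simp only [hψ0 _ this, mul_zero]
    · simp [image_eq_zero_of_notMem_tsupport h2]
  · simp [image_eq_zero_of_notMem_tsupport h1]

lemma admissible_symmetrized {m : ℕ} (hm : 0 < m) {φ : 𝓢(E d, ℂ)}
    (hφ : φ ∈ testSubmodule ((1 / (m : ℝ)) • bodyH d)) :
    Admissible (d + 1) m (symmetrized φ) where
  smooth := contDiff_symmetrized φ
  symmetric := fun σ x => symmetrized_perm φ σ x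
  translation := fun t x => by
    unfold symmetrized
    refine Finset.sum_congr rfl fun σ _ => ?_
    congr 3
    ext i
    simp
  support := by
    have h := fourierSupport_symmetrized (by positivity) hφ
    rwa [mul_one_div] at h
  decay := exists_decay_symmetrized φ

lemma symmetrized_const (φ : 𝓢(E d, ℂ)) (t : ℝ) :
    symmetrized φ (WithLp.toLp 2 fun _ => t) =
      Fintype.card (Equiv.Perm (Fin (d + 1))) * ‖(𝓕⁻ φ : 𝓢(E d, ℂ)) 0‖ ^ 2 := by
  have h : ∀ σ : Equiv.Perm (Fin (d + 1)),
      diffMap d (permMap σ (WithLp.toLp 2 fun _ => t)) = 0 := by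
    intro σ; ext i; simp
  simp only [symmetrized, h, Finset.sum_const, Finset.card_univ, nsmul_eq_mul]

lemma deltaIntegral_symmetrized (φ : 𝓢(E d, ℂ)) :
    deltaIntegral d (fun x => symmetrized φ x * dysonW (d + 1) x) =
      Fintype.card (Equiv.Perm (Fin (d + 1))) *
        ∫ v, ‖(𝓕⁻ φ : 𝓢(E d, ℂ)) v‖ ^ 2 * weight d v := by
  have hint : ∀ σ ∈ (Finset.univ : Finset (Equiv.Perm (Fin (d + 1)))), Integrable fun y : E d =>
      ‖(𝓕⁻ φ : 𝓢(E d, ℂ)) (diffMap d (permMap σ (zeroSum d y)))‖ ^ 2 *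
        dysonW (d + 1) (zeroSum d y) := by
    intro σ _
    have h1 := integrable_comp_linearMap (det_diffMap_permMap_zeroSum_ne_zero σ)
      (integrable_norm_sq_schwartz (𝓕⁻ φ : 𝓢(E d, ℂ)))
    refine h1.mul_bdd (c := 1) ?_ (Eventually.of_forall fun y => ?_)
    · exact ((continuous_dysonW _).comp
        (zeroSum d).continuous_of_finiteDimensional).aestronglyMeasurable
    · rw [Real.norm_of_nonneg (dysonW_nonneg _)]
      exact dysonW_le_one _
  rw [deltaIntegral_eq]
  simp only [symmetrized, Finset.sum_mul]
  rw [integral_finsetSum _ hint, Finset.mul_sum]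
  have h : ∀ σ ∈ (Finset.univ : Finset (Equiv.Perm (Fin (d + 1)))), ((d : ℝ) + 1) * ∫ y : E d,
      ‖(𝓕⁻ φ : 𝓢(E d, ℂ)) (diffMap d (permMap σ (zeroSum d y)))‖ ^ 2 *
        dysonW (d + 1) (zeroSum d y) = ∫ v, ‖(𝓕⁻ φ : 𝓢(E d, ℂ)) v‖ ^ 2 * weight d v :=
    fun σ _ => integral_mul_dysonW_eq σ fun v => ‖(𝓕⁻ φ : 𝓢(E d, ℂ)) v‖ ^ 2
  rw [Finset.sum_congr rfl h, Finset.sum_const, Finset.card_univ, nsmul_eq_mul]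

/-- Each smooth band-limited function that does not vanish at the origin gives a competitor. -/
lemma mem_optValues {m : ℕ} (hm : 0 < m) {φ : 𝓢(E d, ℂ)}
    (hφ : φ ∈ testSubmodule ((1 / (m : ℝ)) • bodyH d)) (h0 : (𝓕⁻ φ : 𝓢(E d, ℂ)) 0 ≠ 0) :
    (∫ v, ‖(𝓕⁻ φ : 𝓢(E d, ℂ)) v‖ ^ 2 * weight d v) / ‖(𝓕⁻ φ : 𝓢(E d, ℂ)) 0‖ ^ 2 ∈
      optValues d m := by
  have hN : (0 : ℝ) < Fintype.card (Equiv.Perm (Fin (d + 1))) := by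
    exact_mod_cast Fintype.card_pos
  have hpos : 0 < ‖(𝓕⁻ φ : 𝓢(E d, ℂ)) 0‖ := norm_pos_iff.mpr h0
  refine ⟨symmetrized φ, admissible_symmetrized hm hφ,
    fun x => Finset.sum_nonneg fun σ _ => by positivity, ?_, ?_⟩
  · rw [symmetrized_const]; positivity
  · rw [symmetrized_const, deltaIntegral_symmetrized]
    field_simp

lemma optValues_nonneg {m : ℕ} {r : ℝ} (hr : r ∈ optValues d m) : 0 ≤ r := by
  obtain ⟨f, -, hf, hf1, rfl⟩ := hr
  rw [deltaIntegral_eq]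
  have : 0 ≤ ∫ y, f (zeroSum d y) * dysonW (d + 1) (zeroSum d y) :=
    integral_nonneg fun y => mul_nonneg (hf _) (dysonW_nonneg _)
  positivity

lemma isGLB_optConst {m : ℕ} (hm : 0 < m) : IsGLB (optValues d m) (optConst d m) := by
  obtain ⟨φ, hφ, hφ0⟩ := exists_testSubmodule_ne_zero
    (interior_smul_bodyH_nonempty (d := d) (a := 1 / (m : ℝ)) (by positivity))
  exact isGLB_csInf ⟨_, mem_optValues hm hφ hφ0⟩ ⟨0, fun r hr => optValues_nonneg hr⟩

/-- The upper bound `c ≤ 1 / K(0, 0)`, by approximating the kernel function at the origin. -/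
lemma optConst_le {m : ℕ} (hm : 0 < m) {K : (Fin d → ℂ) → (Fin d → ℂ) → ℂ}
    (hK : IsReproducingKernel ((1 / (m : ℝ)) • bodyH d) K) :
    optConst d m ≤ 1 / (K 0 0).re := by
  have hm' : (0 : ℝ) < 1 / m := by positivity
  have hΩ := isCompact_smul_bodyH (d := d) hm'
  obtain ⟨-, hpos⟩ := hK.pos hΩ (interior_smul_bodyH_nonempty hm')
  obtain ⟨k, hk, hext, hK0, -⟩ := hK.exists_vec hΩ
  have hquad : ∀ φ ∈ testSubmodule ((1 / (m : ℝ)) • bodyH d),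
      optConst d m * ‖(𝓕⁻ φ : 𝓢(E d, ℂ)) 0‖ ^ 2 ≤
        ∫ x, ‖(𝓕⁻ φ : 𝓢(E d, ℂ)) x‖ ^ 2 * weight d x := by
    intro φ hφ
    by_cases h0 : (𝓕⁻ φ : 𝓢(E d, ℂ)) 0 = 0
    · rw [h0]
      simp only [norm_zero, ne_eq, OfNat.ofNat_ne_zero, not_false_eq_true, zero_pow, mul_zero]
      exact integral_nonneg fun x => mul_nonneg (by positivity) (weight_nonneg x)
    · have hp : 0 < ‖(𝓕⁻ φ : 𝓢(E d, ℂ)) 0‖ := norm_pos_iff.mpr h0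
      rw [← le_div_iff₀ (by positivity)]
      exact (isGLB_optConst hm).1 (mem_optValues hm hφ h0)
  have h := mul_norm_ext_sq_le hΩ (convex_smul_bodyH hm') hquad hk
  have hre : (K 0 0).re = ∫ x, ‖k x‖ ^ 2 * weight d x := by rw [hK0, Complex.ofReal_re]
  have hn : ‖K 0 0‖ = (K 0 0).re := by
    rw [hre, hK0, Complex.norm_real, Real.norm_of_nonneg]
    rw [← hre]; exact hpos.le
  rw [hext, hn, ← hre, pow_two, ← mul_assoc] at h
  rw [le_div_iff₀ hpos]
  exact le_of_mul_le_mul_right (by linarith) hpos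

end Construction

/-! ### Band-limited functions from admissible functions -/

section Restriction

variable {d : ℕ}

lemma exists_integral_eq_mul_integral_comp (e : (E d × ℝ) ≃L[ℝ] E (d + 1)) :
    ∃ c : ℝ, c ≠ 0 ∧ ∀ F : E (d + 1) → ℂ, ∫ x, F x = c * ∫ p : E d × ℝ, F (e p) := by
  have hV : (volume : Measure (E d × ℝ)).IsAddHaarMeasure := by
    rw [Measure.volume_eq_prod]
    infer_instance
  have hH : (Measure.map e (volume : Measure (E d × ℝ))).IsAddHaarMeasure :=
    e.isAddHaarMeasure_map volume
  obtain ⟨c, hc⟩ : ∃ c : NNReal, (volume : Measure (E (d + 1))) =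
      c • Measure.map e (volume : Measure (E d × ℝ)) :=
    ⟨_, Measure.isAddLeftInvariant_eq_smul _ _⟩
  have hc0 : c ≠ 0 := by
    rintro rfl
    rw [zero_smul] at hc
    exact NeZero.ne (volume : Measure (E (d + 1))) hc
  have he : MeasurableEmbedding e := e.toHomeomorph.measurableEmbedding
  refine ⟨c, by exact_mod_cast hc0, fun F => ?_⟩
  conv_lhs => rw [hc]
  rw [integral_smul_nnreal_measure, he.integral_map]
  rfl

/-- The coordinates `(v, t) ↦ (v, 0) + t (1, …, 1)` on `ℝ^{d+1}`. -/
noncomputable def spaceEquiv (d : ℕ) : (E d × ℝ) ≃L[ℝ] E (d + 1) :=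
  LinearEquiv.toContinuousLinearEquiv
    { toFun := fun p => WithLp.toLp 2 fun i => snocZero d p.1 i + p.2
      map_add' := fun p q => by ext i; simp; ring
      map_smul' := fun a p => by ext i; simp; ring
      invFun := fun x => (diffMap d x, x (Fin.last d))
      left_inv := fun p => by
        refine Prod.ext ?_ ?_
        · ext i; simp
        · simp
      right_inv := fun x => by
        ext i
        refine Fin.lastCases ?_ (fun j => ?_) i <;> simp }

lemma spaceEquiv_apply (p : E d × ℝ) (i : Fin (d + 1)) :
    spaceEquiv d p i = snocZero d p.1 i + p.2 := rfl

/-- The frequency coordinates dual to `spaceEquiv`. -/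
noncomputable def freqEquiv (d : ℕ) : (E d × ℝ) ≃L[ℝ] E (d + 1) :=
  LinearEquiv.toContinuousLinearEquiv
    { toFun := fun p => WithLp.toLp 2 (Fin.snoc (α := fun _ => ℝ) p.1 (p.2 - ∑ i, p.1 i))
      map_add' := fun p q => by
        ext i
        refine Fin.lastCases ?_ (fun j => ?_) i
        · simp [Finset.sum_add_distrib]; ring
        · simp
      map_smul' := fun a p => by
        ext i
        refine Fin.lastCases ?_ (fun j => ?_) i
        · simp [← Finset.mul_sum]; ring
        · simp
      invFun := fun ξ => (WithLp.toLp 2 fun i => ξ i.castSucc, ∑ i, ξ i)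
      left_inv := fun p => by
        refine Prod.ext ?_ ?_
        · ext i; simp
        · simp [Fin.sum_univ_castSucc]
      right_inv := fun ξ => by
        ext i
        refine Fin.lastCases ?_ (fun j => ?_) i
        · simp [Fin.sum_univ_castSucc]
        · simp }

lemma freqEquiv_castSucc (p : E d × ℝ) (i : Fin d) : freqEquiv d p i.castSucc = p.1 i := by
  change (WithLp.toLp 2 (Fin.snoc (α := fun _ => ℝ) p.1 (p.2 - ∑ i, p.1 i)) : E (d + 1)) _ = _
  simp

lemma freqEquiv_last (p : E d × ℝ) : freqEquiv d p (Fin.last d) = p.2 - ∑ i, p.1 i := by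
  change (WithLp.toLp 2 (Fin.snoc (α := fun _ => ℝ) p.1 (p.2 - ∑ i, p.1 i)) : E (d + 1)) _ = _
  simp

lemma freqEquiv_zero_right (η : E d) : freqEquiv d (η, 0) = zeroSum d η := by
  ext i
  refine Fin.lastCases ?_ (fun j => ?_) i
  · simp [freqEquiv_last]
  · simp [freqEquiv_castSucc]

lemma inner_freqEquiv_spaceEquiv (p q : E d × ℝ) :
    inner ℝ (freqEquiv d p) (spaceEquiv d q) = inner ℝ p.1 q.1 + p.2 * q.2 := by
  rw [PiLp.inner_apply, PiLp.inner_apply, Fin.sum_univ_castSucc]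
  simp only [freqEquiv_castSucc, freqEquiv_last, spaceEquiv_apply, snocZero_castSucc,
    snocZero_last, RCLike.inner_apply, conj_trivial, add_mul, Finset.sum_add_distrib,
    ← Finset.mul_sum]
  ring

/-- The product of two test functions in the coordinates of `freqEquiv`, as a Schwartz function on
`ℝ^{d+1}` with support in a prescribed set. -/
lemma exists_productTest {ψ : E d → ℝ} {χ : ℝ → ℝ} (hψ : ContDiff ℝ ∞ ψ) (hψc : HasCompactSupport ψ)
    (hχ : ContDiff ℝ ∞ χ) (hχc : HasCompactSupport χ) {s : Set (E (d + 1))}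
    (hs : ∀ p : E d × ℝ, p.1 ∈ tsupport ψ → p.2 ∈ tsupport χ → freqEquiv d p ∈ s) :
    ∃ Φ : 𝓢(E (d + 1), ℂ), tsupport Φ ⊆ s ∧ ∀ p, Φ (freqEquiv d p) = (ψ p.1 : ℂ) * (χ p.2 : ℂ) := by
  set e := freqEquiv d
  set F : E (d + 1) → ℂ := fun ξ => (ψ (e.symm ξ).1 : ℂ) * (χ (e.symm ξ).2 : ℂ) with hF
  have hsupp : tsupport F ⊆ e '' (tsupport ψ ×ˢ tsupport χ) := by
    have hcl : IsCompact (e '' (tsupport ψ ×ˢ tsupport χ)) :=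
      (hψc.isCompact.prod hχc.isCompact).image e.continuous
    refine closure_minimal (fun ξ hξ => ?_) hcl.isClosed
    refine ⟨e.symm ξ, ⟨subset_tsupport _ fun h => hξ ?_, subset_tsupport _ fun h => hξ ?_⟩,
      e.apply_symm_apply ξ⟩
    · simp [hF, h]
    · simp [hF, h]
  have hFc : HasCompactSupport F := by
    refine HasCompactSupport.of_support_subset_isCompact
      ((hψc.isCompact.prod hχc.isCompact).image e.continuous) ((subset_tsupport F).trans hsupp)
  have hFs : ContDiff ℝ ∞ F := by
    refine (Complex.ofRealCLM.contDiff.comp (hψ.comp ?_)).mul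
      (Complex.ofRealCLM.contDiff.comp (hχ.comp ?_))
    · exact contDiff_fst.comp e.symm.contDiff
    · exact contDiff_snd.comp e.symm.contDiff
  refine ⟨hFc.toSchwartzMap hFs, hsupp.trans ?_, fun p => ?_⟩
  · rintro _ ⟨p, hp, rfl⟩
    exact hs p hp.1 hp.2
  · change F (e p) = _
    simp [hF]

/-- For a function of the coordinate differences, the Fourier pairing with a product test function
factorizes. -/
lemma integral_mul_fourier_productTest {g : E d → ℂ} (hg : Integrable g) {f : E (d + 1) → ℂ}
    (hfg : ∀ p : E d × ℝ, f (spaceEquiv d p) = g p.1) (ψ : 𝓢(E d, ℂ)) (χ : 𝓢(ℝ, ℂ))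
    (Φ : 𝓢(E (d + 1), ℂ)) (hΦ : ∀ p, Φ (freqEquiv d p) = ψ p.1 * χ p.2) :
    ∃ c : ℂ, c ≠ 0 ∧
      ∫ x, f x * (𝓕 Φ : 𝓢(E (d + 1), ℂ)) x = c * ((∫ η, ψ η * 𝓕 g η) * χ 0) := by
  obtain ⟨c₁, hc₁, h₁⟩ := exists_integral_eq_mul_integral_comp (spaceEquiv d)
  obtain ⟨c₂, hc₂, h₂⟩ := exists_integral_eq_mul_integral_comp (freqEquiv d)
  have hFΦ : ∀ q : E d × ℝ, (𝓕 Φ : 𝓢(E (d + 1), ℂ)) (spaceEquiv d q) =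
      c₂ * ((𝓕 ψ : 𝓢(E d, ℂ)) q.1 * (𝓕 χ : 𝓢(ℝ, ℂ)) q.2) := by
    intro q
    rw [SchwartzMap.fourier_coe, SchwartzMap.fourier_coe, SchwartzMap.fourier_coe,
      Real.fourier_eq, Real.fourier_eq, Real.fourier_eq, h₂]
    congr 1
    rw [Measure.volume_eq_prod, ← integral_prod_mul (μ := (volume : Measure (E d)))
      (ν := (volume : Measure ℝ))]
    refine integral_congr_ae (Eventually.of_forall fun p => ?_)
    simp only [hΦ, inner_freqEquiv_spaceEquiv, Circle.smul_def, smul_eq_mul, neg_add,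
      AddChar.map_add_eq_mul, Circle.coe_mul]
    have : inner ℝ p.2 q.2 = p.2 * q.2 := by simp [mul_comm]
    rw [this]
    ring
  have hχ0 : ∫ t, (𝓕 χ : 𝓢(ℝ, ℂ)) t = χ 0 := by
    have h0 : (𝓕⁻ (𝓕 χ : 𝓢(ℝ, ℂ)) : 𝓢(ℝ, ℂ)) = χ := FourierTransform.fourierInv_fourier_eq χ
    have h : 𝓕⁻ ((𝓕 χ : 𝓢(ℝ, ℂ)) : ℝ → ℂ) 0 = χ 0 := by
      rw [← SchwartzMap.fourierInv_coe, h0]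
    rw [← h, Real.fourierInv_eq]
    simp
  have hψ : ∫ v, g v * (𝓕 ψ : 𝓢(E d, ℂ)) v = ∫ η, ψ η * 𝓕 g η := by
    have h := VectorFourier.integral_fourierIntegral_smul_eq_flip (L := innerₗ (E d))
      (μ := volume) (ν := volume) Real.continuous_fourierChar continuous_inner ψ.integrable hg
    have e' : (innerₗ (E d)).flip = innerₗ (E d) := by
      ext x y; simp
    rw [e'] at h
    simp only [mul_comm (g _)]
    exact h
  refine ⟨c₁ * c₂, mul_ne_zero (by exact_mod_cast hc₁) (by exact_mod_cast hc₂), ?_⟩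
  rw [h₁]
  simp only [hFΦ, hfg]
  have : ∫ p : E d × ℝ, g p.1 * (c₂ * ((𝓕 ψ : 𝓢(E d, ℂ)) p.1 * (𝓕 χ : 𝓢(ℝ, ℂ)) p.2)) =
      ∫ p : E d × ℝ, c₂ * ((g p.1 * (𝓕 ψ : 𝓢(E d, ℂ)) p.1) * (𝓕 χ : 𝓢(ℝ, ℂ)) p.2) := by
    refine integral_congr_ae (Eventually.of_forall fun p => ?_)
    ring
  rw [this, integral_const_mul, Measure.volume_eq_prod,
    integral_prod_mul (μ := (volume : Measure (E d))) (ν := (volume : Measure ℝ))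
      (fun v => g v * (𝓕 ψ : 𝓢(E d, ℂ)) v), hχ0, hψ]
  ring

variable {m : ℕ} {f : E (d + 1) → ℝ}

lemma Admissible.eq_snocZero_diffMap (hf : Admissible (d + 1) m f) (x : E (d + 1)) :
    f x = f (snocZero d (diffMap d x)) := by
  rw [← hf.translation (-x (Fin.last d)) x]
  congr 1
  ext i
  refine Fin.lastCases ?_ (fun j => ?_) i
  · simp
  · simp [sub_eq_add_neg]

lemma Admissible.continuous_restrict (hf : Admissible (d + 1) m f) :
    Continuous fun v => f (snocZero d v) :=
  hf.smooth.continuous.comp (snocZero d).continuous_of_finiteDimensional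

lemma Admissible.integrable_restrict (hf : Admissible (d + 1) m f) :
    Integrable fun v => f (snocZero d v) := by
  have hdec : ∀ k : ℕ, ∃ C : ℝ, ∀ v : E d, ‖v‖ ^ k * ‖f (snocZero d v)‖ ≤ C := by
    intro k
    obtain ⟨C, hC⟩ := hf.decay k
    set M := ‖LinearMap.toContinuousLinearMap (diffMap d)‖
    refine ⟨M ^ k * C, fun v => ?_⟩
    have h1 : ‖v‖ ≤ M * ‖centered d v‖ := by
      conv_lhs => rw [← diffMap_centered v]
      exact (LinearMap.toContinuousLinearMap (diffMap d)).le_opNorm _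
    have h2 := hC (centered d v) (sum_centered v)
    rw [hf.eq_snocZero_diffMap (centered d v), diffMap_centered] at h2
    calc ‖v‖ ^ k * ‖f (snocZero d v)‖ ≤ (M * ‖centered d v‖) ^ k * ‖f (snocZero d v)‖ := by gcongr
      _ = M ^ k * (‖centered d v‖ ^ k * |f (snocZero d v)|) := by
          rw [mul_pow, mul_assoc, Real.norm_eq_abs]
      _ ≤ M ^ k * C := by gcongr
  obtain ⟨C₁, h₁⟩ := hdec 0
  obtain ⟨C₂, h₂⟩ := hdec (0 + (volume : Measure (E d)).integrablePower)
  have h := integrable_of_le_of_pow_mul_le (μ := (volume : Measure (E d)))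
    (f := fun v => f (snocZero d v)) (k := 0) (fun v => by simpa using h₁ v) h₂
    hf.continuous_restrict.aestronglyMeasurable
  simp only [pow_zero, one_mul] at h
  exact (integrable_norm_iff hf.continuous_restrict.aestronglyMeasurable).mp h

lemma Admissible.deltaIntegral_mul_dysonW (hf : Admissible (d + 1) m f) :
    deltaIntegral d (fun x => f x * dysonW (d + 1) x) = ∫ v, f (snocZero d v) * weight d v := by
  rw [← integral_mul_dysonW_eq 1 fun v => f (snocZero d v)]
  congr 1
  funext x
  rw [hf.eq_snocZero_diffMap x]
  rfl

/-- The Fourier transform of the restriction of an admissible function to `x_n = 0` vanishes off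
`(2/m) H`. -/
lemma Admissible.tsupport_fourier_subset (hm : 0 < m) (hf : Admissible (d + 1) m f) :
    tsupport (𝓕 fun v : E d => (f (snocZero d v) : ℂ)) ⊆ (2 / (m : ℝ)) • bodyH d := by
  have hm' : (0 : ℝ) < 2 / m := by positivity
  set g : E d → ℂ := fun v => (f (snocZero d v) : ℂ) with hg
  have hgi : Integrable g := hf.integrable_restrict.ofReal
  have hcont : Continuous (𝓕 g) := VectorFourier.fourierIntegral_continuous
    Real.continuous_fourierChar continuous_inner hgi
  refine closure_minimal (fun η₀ hη₀ => ?_) (isCompact_smul_bodyH hm').isClosed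
  by_contra hnot
  rw [smul_bodyH_eq hm', Set.mem_ofPred_eq, not_le] at hnot
  have hξ : zeroSum d η₀ ∉ fourierSupport f := by
    intro hmem
    have h := hf.support hmem
    rw [Set.mem_ofPred_eq] at h
    have h2 : ∑ i, |zeroSum d η₀ i| = bodyNorm η₀ := sum_abs_permMap_zeroSum 1 η₀
    rw [h2] at h
    exact lt_asymm h hnot
  rw [fourierSupport, Distribution.notMem_dsupport_iff] at hξ
  obtain ⟨s, hvan, hs, hmem⟩ := hξ
  have hnhds : (freqEquiv d) ⁻¹' s ∈ 𝓝 (η₀, (0 : ℝ)) := by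
    refine (freqEquiv d).continuous.continuousAt.preimage_mem_nhds ?_
    rw [freqEquiv_zero_right]
    exact hs.mem_nhds hmem
  obtain ⟨U, hU, V, hV, hUV⟩ := mem_nhds_prod_iff.mp hnhds
  obtain ⟨χ, hχs, hχc, hχ, -, hχ0⟩ := exists_contDiff_tsupport_subset (n := ⊤) hV
  have hzero : ∀ᵐ η : E d, η ∈ interior U → 𝓕 g η = 0 := by
    refine isOpen_interior.ae_eq_zero_of_integral_contDiff_smul_eq_zero
      (hcont.locallyIntegrable.locallyIntegrableOn _) fun ψ hψ hψc hψs => ?_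
    obtain ⟨Φ, hΦs, hΦ⟩ := exists_productTest hψ hψc hχ hχc (s := s)
      fun p h1 h2 => hUV (Set.mk_mem_prod (interior_subset (hψs h1)) (hχs h2))
    have hψ₁ : HasCompactSupport (Complex.ofRealCLM ∘ ψ) := hψc.comp_left rfl
    have hψ₂ : ContDiff ℝ ∞ (Complex.ofRealCLM ∘ ψ) := Complex.ofRealCLM.contDiff.comp hψ
    have hχ₁ : HasCompactSupport (Complex.ofRealCLM ∘ χ) := hχc.comp_left rfl
    have hχ₂ : ContDiff ℝ ∞ (Complex.ofRealCLM ∘ χ) := Complex.ofRealCLM.contDiff.comp hχ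
    have hfg : ∀ p : E d × ℝ, ((f (spaceEquiv d p) : ℝ) : ℂ) = g p.1 := by
      intro p
      have h1 : diffMap d (spaceEquiv d p) = p.1 :=
        congrArg Prod.fst ((spaceEquiv d).symm_apply_apply p)
      rw [hf.eq_snocZero_diffMap, h1]
    obtain ⟨c, hc, h⟩ := integral_mul_fourier_productTest hgi (f := fun x => (f x : ℂ)) hfg
      (hψ₁.toSchwartzMap hψ₂) (hχ₁.toSchwartzMap hχ₂) Φ hΦ
    have h0 : ∫ x, (f x : ℂ) * (𝓕 Φ : 𝓢(E (d + 1), ℂ)) x = 0 := hvan Φ hΦs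
    rw [h0] at h
    have hχ0' : (hχ₁.toSchwartzMap hχ₂) 0 = 1 := by
      change ((χ 0 : ℝ) : ℂ) = 1
      rw [hχ0, Complex.ofReal_one]
    rw [hχ0', mul_one] at h
    simpa using (mul_eq_zero.mp h.symm).resolve_left hc
  have hopen : IsOpen (interior U ∩ {η | 𝓕 g η ≠ 0}) :=
    isOpen_interior.inter (isOpen_ne_fun hcont continuous_const)
  have hpos := hopen.measure_pos volume ⟨η₀, mem_interior_iff_mem_nhds.mpr hU, hη₀⟩
  refine hpos.ne' (measure_mono_null (fun η hη => ?_) hzero)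
  exact fun h => hη.2 (h hη.1)

end Restriction

/-! ### Sums of squares -/

section SumOfSquares

variable {d : ℕ} {Ω : Set (E d)}

/-- Weak continuity of the pairing with a fixed `L²` function along an almost everywhere convergent
sequence bounded in `L²`. No mass is lost in the limit, since the part of `s N` larger than `T k`
contributes at most `C / T`. -/
lemma le_integral_of_tendsto {α : Type*} [MeasurableSpace α] {μ : Measure α} {s : ℕ → α → ℝ}
    {s₀ k : α → ℝ} {C : ℝ} (hs : ∀ N x, 0 ≤ s N x) (hk : ∀ x, 0 ≤ k x) (hs₀ : ∀ x, 0 ≤ s₀ x)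
    (hsm : ∀ N, AEStronglyMeasurable (s N) μ) (hkm : AEStronglyMeasurable k μ)
    (hs2 : ∀ N, Integrable (fun x => s N x ^ 2) μ) (hC : ∀ N, ∫ x, s N x ^ 2 ∂μ ≤ C)
    (hk2 : Integrable (fun x => k x ^ 2) μ) (hs₀k : Integrable (fun x => s₀ x * k x) μ)
    (hlim : ∀ᵐ x ∂μ, Tendsto (fun N => s N x) atTop (𝓝 (s₀ x)))
    {b : ℕ → ℝ} {b₀ : ℝ} (hb : Tendsto b atTop (𝓝 b₀)) (hle : ∀ N, b N ≤ ∫ x, s N x * k x ∂μ) :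
    b₀ ≤ ∫ x, s₀ x * k x ∂μ := by
  have key : ∀ T : ℝ, 0 < T → b₀ ≤ ∫ x, s₀ x * k x ∂μ + C / T := by
    intro T hT
    have hmin_int : ∀ N, Integrable (fun x => min (s N x) (T * k x) * k x) μ := by
      intro N
      refine (hk2.const_mul T).mono' (((hsm N).inf (hkm.const_mul T)).mul hkm)
        (Eventually.of_forall fun x => ?_)
      have h0 : 0 ≤ min (s N x) (T * k x) := le_min (hs N x) (mul_nonneg hT.le (hk x))
      rw [Real.norm_of_nonneg (mul_nonneg h0 (hk x))]
      calc min (s N x) (T * k x) * k x ≤ T * k x * k x :=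
            mul_le_mul_of_nonneg_right (min_le_right _ _) (hk x)
        _ = T * k x ^ 2 := by ring
    have hdct : Tendsto (fun N => ∫ x, min (s N x) (T * k x) * k x ∂μ) atTop
        (𝓝 (∫ x, min (s₀ x) (T * k x) * k x ∂μ)) := by
      refine tendsto_integral_of_dominated_convergence (fun x => T * k x ^ 2)
        (fun N => (hmin_int N).aestronglyMeasurable) (hk2.const_mul T) (fun N => ?_) ?_
      · refine Eventually.of_forall fun x => ?_
        have h0 : 0 ≤ min (s N x) (T * k x) := le_min (hs N x) (mul_nonneg hT.le (hk x))
        rw [Real.norm_of_nonneg (mul_nonneg h0 (hk x))]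
        calc min (s N x) (T * k x) * k x ≤ T * k x * k x :=
              mul_le_mul_of_nonneg_right (min_le_right _ _) (hk x)
          _ = T * k x ^ 2 := by ring
      · filter_upwards [hlim] with x hx
        exact (hx.min tendsto_const_nhds).mul_const _
    have hbound : ∀ N, b N ≤ ∫ x, min (s N x) (T * k x) * k x ∂μ + C / T := by
      intro N
      refine (hle N).trans ?_
      have hpt : ∀ x, s N x * k x ≤ min (s N x) (T * k x) * k x + s N x ^ 2 / T := by
        intro x
        rcases le_total (s N x) (T * k x) with h | h
        · rw [min_eq_left h]
          have : 0 ≤ s N x ^ 2 / T := by positivity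
          linarith
        · rw [min_eq_right h]
          have h1 : k x ≤ s N x / T := by rw [le_div_iff₀ hT]; linarith
          have h2 : s N x * k x ≤ s N x * (s N x / T) := mul_le_mul_of_nonneg_left h1 (hs N x)
          have h3 : 0 ≤ T * k x * k x := mul_nonneg (mul_nonneg hT.le (hk x)) (hk x)
          have h4 : s N x * (s N x / T) = s N x ^ 2 / T := by ring
          linarith
      calc ∫ x, s N x * k x ∂μ ≤ ∫ x, (min (s N x) (T * k x) * k x + s N x ^ 2 / T) ∂μ :=
            integral_mono_of_nonneg (Eventually.of_forall fun x => mul_nonneg (hs N x) (hk x))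
              ((hmin_int N).add ((hs2 N).div_const T)) (Eventually.of_forall hpt)
        _ = ∫ x, min (s N x) (T * k x) * k x ∂μ + (∫ x, s N x ^ 2 ∂μ) / T := by
            rw [integral_add (hmin_int N) ((hs2 N).div_const T), integral_div]
        _ ≤ _ := by
            gcongr
            exact hC N
    refine (le_of_tendsto_of_tendsto' hb (hdct.add_const _) hbound).trans ?_
    refine add_le_add ?_ le_rfl
    refine integral_mono_of_nonneg (Eventually.of_forall fun x => ?_) hs₀k
      (Eventually.of_forall fun x => ?_)
    · exact mul_nonneg (le_min (hs₀ x) (mul_nonneg hT.le (hk x))) (hk x)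
    · exact mul_le_mul_of_nonneg_right (min_le_left _ _) (hk x)
  have hlimT : Tendsto (fun T : ℝ => ∫ x, s₀ x * k x ∂μ + C / T) atTop
      (𝓝 (∫ x, s₀ x * k x ∂μ + 0)) :=
    tendsto_const_nhds.add (tendsto_const_nhds.div_atTop tendsto_id)
  rw [add_zero] at hlimT
  exact ge_of_tendsto hlimT ((eventually_gt_atTop 0).mono fun T hT => key T hT)

/-- The square root of a finite sum of squares of band-limited functions, as a continuous function
on `ℝ^d`. -/
noncomputable def rootSum {N : ℕ} (G : Fin N → L2 d) (x : E d) : ℝ :=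
  ‖(WithLp.toLp 2 fun j => ext (G j) (toC x) : EuclideanSpace ℂ (Fin N))‖

lemma rootSum_sq {N : ℕ} (G : Fin N → L2 d) (x : E d) :
    rootSum G x ^ 2 = ∑ j, ‖ext (G j) (toC x)‖ ^ 2 := by
  rw [rootSum, EuclideanSpace.norm_sq_eq]

lemma rootSum_nonneg {N : ℕ} (G : Fin N → L2 d) (x : E d) : 0 ≤ rootSum G x := norm_nonneg _

lemma continuous_rootSum (hΩ : IsCompact Ω) {N : ℕ} {G : Fin N → L2 d} (hG : ∀ j, G j ∈ PW Ω) :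
    Continuous (rootSum G) := by
  unfold rootSum
  refine ((PiLp.continuous_toLp 2 _).comp (continuous_pi fun j => ?_)).norm
  exact continuous_ext_toC hΩ (hG j)

lemma rootSum_sq_ae_eq (hΩ : IsCompact Ω) {N : ℕ} {G : Fin N → L2 d} (hG : ∀ j, G j ∈ PW Ω) :
    (fun x => rootSum G x ^ 2) =ᵐ[volume] fun x => ∑ j, ‖G j x‖ ^ 2 := by
  filter_upwards [ae_all_iff.mpr fun j => ext_toC_ae_eq hΩ (hG j)] with x hx
  rw [rootSum_sq]
  exact Finset.sum_congr rfl fun j _ => by rw [hx j]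

lemma integrable_rootSum_sq (hΩ : IsCompact Ω) {N : ℕ} {G : Fin N → L2 d} (hG : ∀ j, G j ∈ PW Ω) :
    Integrable fun x => rootSum G x ^ 2 :=
  (integrable_finsetSum _ fun j _ => integrable_norm_sq (G j)).congr
    (rootSum_sq_ae_eq hΩ hG).symm

lemma integral_rootSum_sq (hΩ : IsCompact Ω) {N : ℕ} {G : Fin N → L2 d} (hG : ∀ j, G j ∈ PW Ω) :
    ∫ x, rootSum G x ^ 2 = ∑ j, ‖G j‖ ^ 2 := by
  rw [integral_congr_ae (rootSum_sq_ae_eq hΩ hG),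
    integral_finsetSum _ fun j _ => integrable_norm_sq (G j)]
  exact Finset.sum_congr rfl fun j _ => (norm_sq_eq_integral _).symm

/-- Square roots of sums of squares in `PW Ω` are equicontinuous at the origin. -/
lemma exists_rootSum_le (hΩ : IsCompact Ω) : ∃ A : ℝ, 0 ≤ A ∧ ∀ (N : ℕ) (G : Fin N → L2 d),
    (∀ j, G j ∈ PW Ω) → ∀ x, rootSum G x ≤ rootSum G 0 + A * ‖x‖ * √(∑ j, ‖G j‖ ^ 2) := by
  obtain ⟨A, hA⟩ := norm_ext_sub_le hΩ
  refine ⟨|A|, abs_nonneg A, fun N G hG x => ?_⟩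
  set a : EuclideanSpace ℂ (Fin N) := WithLp.toLp 2 fun j => ext (G j) (toC x)
  set b : EuclideanSpace ℂ (Fin N) := WithLp.toLp 2 fun j => ext (G j) (toC 0)
  have h1 : ‖a - b‖ ≤ |A| * ‖x‖ * √(∑ j, ‖G j‖ ^ 2) := by
    rw [EuclideanSpace.norm_eq, ← Real.sqrt_sq (by positivity : 0 ≤ |A| * ‖x‖),
      ← Real.sqrt_mul (by positivity), Finset.mul_sum]
    refine Real.sqrt_le_sqrt (Finset.sum_le_sum fun j _ => ?_)
    rw [← mul_pow]
    gcongr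
    refine (hA _ (hG j) x).trans ?_
    gcongr
    exact le_abs_self A
  have h2 : ‖a‖ ≤ ‖b‖ + ‖a - b‖ := by
    simpa using norm_add_le b (a - b)
  exact h2.trans (add_le_add le_rfl h1)

/-- The reproducing property bounds the root of a sum of squares at the origin. -/
lemma rootSum_zero_le (hΩ : IsCompact Ω) {k : L2 d}
    (hrep : ∀ g ∈ PW Ω, ext g 0 = inner ℂ (weightMul d k) g) {N : ℕ} {G : Fin N → L2 d}
    (hG : ∀ j, G j ∈ PW Ω) :
    rootSum G 0 ≤ ∫ x, rootSum G x * (‖k x‖ * weight d x) := by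
  set u : L2 d := ∑ j, conj (ext (G j) 0) • G j with hu
  have hext : inner ℂ (weightMul d k) u = ((rootSum G 0 ^ 2 : ℝ) : ℂ) := by
    rw [hu, inner_sum, rootSum_sq, toC_zero]
    push_cast
    refine Finset.sum_congr rfl fun j _ => ?_
    rw [inner_smul_right, ← hrep _ (hG j), mul_comm, Complex.mul_conj, Complex.normSq_eq_norm_sq]
    push_cast
    rfl
  have hpt : ∀ᵐ x, ‖u x‖ ≤ rootSum G 0 * rootSum G x := by
    have h1 : ∀ᵐ x, u x = ∑ j, conj (ext (G j) 0) * G j x := by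
      have h3 := Lp.coeFn_finsetSum Finset.univ fun j => conj (ext (G j) 0) • G j
      filter_upwards [h3, ae_all_iff.mpr fun j =>
        Lp.coeFn_smul (conj (ext (G j) 0)) (G j)] with x hx hx2
      rw [hu, hx]
      simp [hx2]
    filter_upwards [h1, ae_all_iff.mpr fun j => ext_toC_ae_eq hΩ (hG j)] with x hx hx2
    have h4 : u x = inner ℂ (WithLp.toLp 2 fun j => ext (G j) (toC 0) : EuclideanSpace ℂ (Fin N))
        (WithLp.toLp 2 fun j => ext (G j) (toC x) : EuclideanSpace ℂ (Fin N)) := by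
      rw [hx, PiLp.inner_apply]
      refine Finset.sum_congr rfl fun j _ => ?_
      rw [RCLike.inner_apply, toC_zero, mul_comm, ← hx2 j]
    rw [h4]
    exact norm_inner_le_norm _ _
  have hint : Integrable fun x => rootSum G x * (‖k x‖ * weight d x) := by
    have h1 : MemLp (rootSum G) 2 :=
      (memLp_two_iff_integrable_sq (continuous_rootSum hΩ hG).aestronglyMeasurable).mpr
        (integrable_rootSum_sq hΩ hG)
    have h2 := (h1.integrable_mul (Lp.memLp k).norm).mul_bdd (c := 1)
      (continuous_weight d).aestronglyMeasurable (Eventually.of_forall fun x => by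
        rw [Real.norm_of_nonneg (weight_nonneg x)]; exact weight_le_one x)
    refine h2.congr (Eventually.of_forall fun x => ?_)
    simp [mul_assoc]
  have hmain : rootSum G 0 ^ 2 ≤ rootSum G 0 * ∫ x, rootSum G x * (‖k x‖ * weight d x) := by
    calc rootSum G 0 ^ 2 = ‖inner ℂ (weightMul d k) u‖ := by
          rw [hext, Complex.norm_real, Real.norm_of_nonneg (by positivity)]
      _ ≤ ∫ x, ‖u x * conj (k x) * (weight d x : ℂ)‖ := by
          rw [inner_weightMul]
          exact norm_integral_le_integral_norm _
      _ ≤ ∫ x, rootSum G 0 * (rootSum G x * (‖k x‖ * weight d x)) := by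
          refine integral_mono_of_nonneg (Eventually.of_forall fun x => norm_nonneg _)
            (hint.const_mul _) ?_
          filter_upwards [hpt] with x hx
          rw [norm_mul, norm_mul, RCLike.norm_conj, Complex.norm_real,
            Real.norm_of_nonneg (weight_nonneg x)]
          have h0 : 0 ≤ ‖k x‖ * weight d x := mul_nonneg (norm_nonneg _) (weight_nonneg x)
          calc ‖u x‖ * ‖k x‖ * weight d x = ‖u x‖ * (‖k x‖ * weight d x) := by ring
            _ ≤ rootSum G 0 * rootSum G x * (‖k x‖ * weight d x) := by gcongr
            _ = _ := by ring
      _ = _ := integral_const_mul _ _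
  rcases (rootSum_nonneg G 0).eq_or_lt with h0 | h0
  · rw [← h0]
    exact integral_nonneg fun x => mul_nonneg (rootSum_nonneg G x)
      (mul_nonneg (norm_nonneg _) (weight_nonneg x))
  · rw [pow_two] at hmain
    exact le_of_mul_le_mul_left hmain h0

/-- For a sum of squares `g`, the value at the origin is controlled by the weighted integral. -/
lemma IsSumOfSquares.apply_zero_le (hΩ : IsCompact Ω) {k : L2 d}
    (hrep : ∀ g ∈ PW Ω, ext g 0 = inner ℂ (weightMul d k) g)
    (hκ : 0 < ∫ x, ‖k x‖ ^ 2 * weight d x) {g : E d → ℝ} (hg : IsSumOfSquares Ω g)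
    (hgc : Continuous g) (hgi : Integrable g) (hg0 : ∀ x, 0 ≤ g x) :
    g 0 ≤ (∫ x, ‖k x‖ ^ 2 * weight d x) * ∫ x, g x * weight d x := by
  obtain ⟨G', hG', ⟨C, hC⟩, hlim⟩ := hg
  set G : (N : ℕ) → Fin N → L2 d := fun N j => G' N j with hGdef
  have hG : ∀ N j, G N j ∈ PW Ω := fun N j => hG' N j
  have hC' : ∀ N, ∑ j, ‖G N j‖ ^ 2 ≤ C := fun N => by
    have := hC N
    rwa [Finset.sum_range] at this
  have hlim' : ∀ᵐ x, Tendsto (fun N => rootSum (G N) x) atTop (𝓝 (√(g x))) := by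
    filter_upwards [hlim, ae_all_iff.mpr fun N => rootSum_sq_ae_eq hΩ (hG N)] with x hx hx2
    have h := (Real.continuous_sqrt.tendsto _).comp hx
    refine h.congr fun N => ?_
    rw [Function.comp_apply, Finset.sum_range, ← hx2 N, Real.sqrt_sq (rootSum_nonneg _ _)]
  have hk2 : Integrable fun x => (‖k x‖ * weight d x) ^ 2 := by
    have h := (integrable_norm_sq_mul_weight k).mul_bdd (c := 1)
      (continuous_weight d).aestronglyMeasurable (Eventually.of_forall fun x => by
        rw [Real.norm_of_nonneg (weight_nonneg x)]; exact weight_le_one x)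
    refine h.congr (Eventually.of_forall fun x => ?_)
    simp only
    ring
  have hkm : AEStronglyMeasurable (fun x => ‖k x‖ * weight d x) volume :=
    (Lp.aestronglyMeasurable k).norm.mul (continuous_weight d).aestronglyMeasurable
  have hsqrt : MemLp (fun x => √(g x)) 2 := by
    refine (memLp_two_iff_integrable_sq hgc.sqrt.aestronglyMeasurable).mpr ?_
    simpa only [Real.sq_sqrt (hg0 _)] using hgi
  have hs₀k : Integrable fun x => √(g x) * (‖k x‖ * weight d x) := by
    have h2 := (hsqrt.integrable_mul (Lp.memLp k).norm).mul_bdd (c := 1)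
      (continuous_weight d).aestronglyMeasurable (Eventually.of_forall fun x => by
        rw [Real.norm_of_nonneg (weight_nonneg x)]; exact weight_le_one x)
    refine h2.congr (Eventually.of_forall fun x => ?_)
    simp [mul_assoc]
  obtain ⟨A, hA0, hA⟩ := exists_rootSum_le hΩ
  set I := ∫ x, √(g x) * (‖k x‖ * weight d x) with hI
  have hae : ∀ᵐ x, √(g x) - A * ‖x‖ * √C ≤ I := by
    filter_upwards [hlim'] with x hx
    refine le_integral_of_tendsto (fun N x => rootSum_nonneg (G N) x)
      (fun x => mul_nonneg (norm_nonneg _) (weight_nonneg x)) (fun x => Real.sqrt_nonneg _)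
      (fun N => (continuous_rootSum hΩ (hG N)).aestronglyMeasurable) hkm
      (fun N => integrable_rootSum_sq hΩ (hG N))
      (fun N => (integral_rootSum_sq hΩ (hG N)).trans_le (hC' N)) hk2 hs₀k hlim'
      (hx.sub_const (A * ‖x‖ * √C)) fun N => ?_
    refine le_trans ?_ (rootSum_zero_le hΩ hrep (hG N))
    have h1 := hA N (G N) (hG N) x
    have h2 : A * ‖x‖ * √(∑ j, ‖G N j‖ ^ 2) ≤ A * ‖x‖ * √C := by
      gcongr
      exact hC' N
    linarith
  have hclosed : IsClosed {x : E d | √(g x) - A * ‖x‖ * √C ≤ I} :=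
    isClosed_le (by fun_prop) continuous_const
  have h0 : √(g 0) ≤ I := by
    have h := (Measure.dense_of_ae hae).closure_eq
    rw [hclosed.closure_eq] at h
    have h0 : (0 : E d) ∈ {x : E d | √(g x) - A * ‖x‖ * √C ≤ I} := by rw [h]; trivial
    simpa using h0
  have hgw : Integrable fun x => g x * weight d x :=
    hgi.mul_bdd (c := 1) (continuous_weight d).aestronglyMeasurable
      (Eventually.of_forall fun x => by
        rw [Real.norm_of_nonneg (weight_nonneg x)]; exact weight_le_one x)
  set κ := ∫ x, ‖k x‖ ^ 2 * weight d x with hκdef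
  rcases (hg0 0).eq_or_lt with hz | hz
  · rw [← hz]
    exact mul_nonneg hκ.le (integral_nonneg fun x => mul_nonneg (hg0 x) (weight_nonneg x))
  -- Cauchy–Schwarz, in the form `2 √g |k| ≤ t g + |k|² / t` with the optimal `t`
  set b := √(g 0) with hb
  have hb0 : 0 < b := Real.sqrt_pos.mpr hz
  have hbsq : b ^ 2 = g 0 := Real.sq_sqrt hz.le
  set t := κ / b with ht
  have ht0 : 0 < t := by positivity
  have hcs : 2 * I ≤ t * (∫ x, g x * weight d x) + t⁻¹ * κ := by
    rw [hI, hκdef, ← integral_const_mul, ← integral_const_mul, ← integral_const_mul,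
      ← integral_add (hgw.const_mul _) ((integrable_norm_sq_mul_weight k).const_mul _)]
    refine integral_mono (hs₀k.const_mul 2)
      ((hgw.const_mul _).add ((integrable_norm_sq_mul_weight k).const_mul _)) fun x => ?_
    have hq : 2 * √(g x) * ‖k x‖ ≤ t * g x + t⁻¹ * ‖k x‖ ^ 2 := by
      have h1 : 0 ≤ t⁻¹ * (t * √(g x) - ‖k x‖) ^ 2 := by positivity
      have h2 : t⁻¹ * (t * √(g x) - ‖k x‖) ^ 2 =
          t * √(g x) ^ 2 - 2 * √(g x) * ‖k x‖ + t⁻¹ * ‖k x‖ ^ 2 := by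
        field_simp
        ring
      rw [h2, Real.sq_sqrt (hg0 x)] at h1
      linarith
    have := mul_le_mul_of_nonneg_right hq (weight_nonneg x)
    simp only
    linarith
  have ht1 : t⁻¹ * κ = b := by rw [ht]; field_simp
  rw [ht1] at hcs
  have hfin : b ≤ t * ∫ x, g x * weight d x := by linarith
  rw [ht, div_mul_eq_mul_div, le_div_iff₀ hb0] at hfin
  rw [← hbsq, pow_two]
  exact hfin

/-- If all nonnegative integrable band-limited functions are sums of squares, the upper bound for the
optimal constant is attained. -/
lemma le_optConst {m : ℕ} (hm : 0 < m) {K : (Fin d → ℂ) → (Fin d → ℂ) → ℂ}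
    (hK : IsReproducingKernel ((1 / (m : ℝ)) • bodyH d) K)
    (hsos : ∀ g : E d → ℝ, Integrable g → (∀ x, 0 ≤ g x) →
      tsupport (𝓕 (fun x => (g x : ℂ))) ⊆ (2 / (m : ℝ)) • bodyH d →
      IsSumOfSquares ((1 / (m : ℝ)) • bodyH d) g) :
    1 / (K 0 0).re ≤ optConst d m := by
  have hm' : (0 : ℝ) < 1 / m := by positivity
  have hΩ := isCompact_smul_bodyH (d := d) hm'
  obtain ⟨-, hpos⟩ := hK.pos hΩ (interior_smul_bodyH_nonempty hm')
  obtain ⟨k, hk, hext, hK0, hrep⟩ := hK.exists_vec hΩ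
  have hre : (K 0 0).re = ∫ x, ‖k x‖ ^ 2 * weight d x := by rw [hK0, Complex.ofReal_re]
  refine (isGLB_optConst hm).2 ?_
  rintro r ⟨f, hf, hf0, hf1, rfl⟩
  have h1 : f (WithLp.toLp 2 fun _ => 1) = f (snocZero d 0) := by
    rw [hf.eq_snocZero_diffMap]
    congr 2
    ext i; simp
  have h := (hsos (fun v => f (snocZero d v)) hf.integrable_restrict (fun v => hf0 _)
    (hf.tsupport_fourier_subset hm)).apply_zero_le hΩ hrep (hre ▸ hpos) hf.continuous_restrict
      hf.integrable_restrict fun v => hf0 _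
  rw [← hre] at h
  rw [hf.deltaIntegral_mul_dysonW, h1, div_mul_eq_mul_div, one_mul]
  rw [h1] at hf1
  rw [div_le_div_iff₀ hpos hf1]
  linarith

end SumOfSquares

end PairKernel

/-- Throughout `n = d + 1` (so `n ≥ 1` is arbitrary) and `Ω = (1/m) H_{n-1}`. -/
theorem theorem2 (d m : ℕ) (hm : 0 < m) :
    -- the weighted norm on the Paley-Wiener space is equivalent to the `L²` norm
    (∃ a : ℝ, 0 < a ∧ ∀ g ∈ PairKernel.PW ((1 / (m : ℝ)) • PairKernel.bodyH d),
      a * ‖g‖ ^ 2 ≤ ∫ x, ‖g x‖ ^ 2 * PairKernel.weight d x ∧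
      ∫ x, ‖g x‖ ^ 2 * PairKernel.weight d x ≤ ‖g‖ ^ 2) ∧
    -- there is a (unique) reproducing kernel
    (∃! K : (Fin d → ℂ) → (Fin d → ℂ) → ℂ,
      PairKernel.IsReproducingKernel ((1 / (m : ℝ)) • PairKernel.bodyH d) K) ∧
    -- the constant is a genuine infimum
    IsGLB (PairKernel.optValues d m) (PairKernel.optConst d m) ∧
    ∀ K : (Fin d → ℂ) → (Fin d → ℂ) → ℂ,
      PairKernel.IsReproducingKernel ((1 / (m : ℝ)) • PairKernel.bodyH d) K →
      (K 0 0).im = 0 ∧ 0 < (K 0 0).re ∧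
      PairKernel.optConst d m ≤ 1 / (K 0 0).re ∧
      ((∀ g : PairKernel.E d → ℝ, Integrable g → (∀ x, 0 ≤ g x) →
          tsupport (𝓕 (fun x => (g x : ℂ))) ⊆ (2 / (m : ℝ)) • PairKernel.bodyH d →
          PairKernel.IsSumOfSquares ((1 / (m : ℝ)) • PairKernel.bodyH d) g) →
        PairKernel.optConst d m = 1 / (K 0 0).re) := by
  have hm' : (0 : ℝ) < 1 / m := by positivity
  have hΩ := PairKernel.isCompact_smul_bodyH (d := d) hm'
  obtain ⟨a, ha, hle⟩ := PairKernel.exists_le_integral_norm_sq_mul_weight hΩ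
  refine ⟨⟨a, ha, fun g hg => ⟨hle g hg, PairKernel.integral_norm_sq_mul_weight_le g⟩⟩,
    PairKernel.existsUnique_reproducingKernel hΩ, PairKernel.isGLB_optConst hm, fun K hK => ?_⟩
  obtain ⟨him, hpos⟩ := hK.pos hΩ (PairKernel.interior_smul_bodyH_nonempty hm')
  exact ⟨him, hpos, PairKernel.optConst_le hm hK, fun hsos =>
    le_antisymm (PairKernel.optConst_le hm hK) (PairKernel.le_optConst hm hK hsos)⟩
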